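/- Let $\Gamma\subset\mathbb R$ be a closed bounded set of Lebesgue measure zero. Call $\chi\in C_0^\infty(\mathbb R)$ with $\chi'\in C_0^\infty(\mathbb R\setminus\Gamma)$ a cutting function. Let $A$ be a Schrödinger operator with $\delta'$-interaction on $\Gamma$, that is, a self-adjoint operator on $L_2(\mathbb R)$ (complex-valued functions) such that (i) $A$ extends the minimal operator $\varphi\mapsto-\varphi''$, $\varphi\in C_0^\infty(\mathbb R\setminus\Gamma)$; (ii) $A$ is local: $\chi u\in\mathfrak D(A)$ for every $u\in\mathfrak D(A)$ and every cutting function $\chi$; (iii) $A$ is non-splitting: for no $x_0\in\Gamma$ is $A=A_1\oplus A_2$ with self-adjoint operators $A_1$ on $L_2(-\infty,x_0)$ and $A_2$ on $L_2(x_0,\infty)$; (iv) every cutting function belongs to $\mathfrak D(A)$. An isolated point $x_0$ of $\Gamma$ has intensity $\beta\in\mathbb R$ if every $\psi\in\mathfrak D(A)$ (taken as its representative that is differentiable in a punctured neighbourhood of $x_0$) has one-sided limits $\psi(x_0\pm0)$, $\psi'(x_0\pm0)$ satisfying $$\psi'(x_0+0)=\psi'(x_0-0),\qquad \psi(x_0+0)-\psi(x_0-0)=\tfrac{\beta}{2}\bigl[\psi'(x_0+0)+\psi'(x_0-0)\bigr].$$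 Suppose that the negative spectrum of $A$ is discrete: every $\lambda\in\sigma(A)$ with $\lambda<0$ is an isolated point of $\sigma(A)$ and an eigenvalue of finite multiplicity. Then the number of negative eigenvalues of $A$, counted with multiplicity and possibly infinite, is at least the number (possibly infinite) of isolated points of $\Gamma$ with negative intensity. -/

import Mathlib

open MeasureTheory Filter Topology Set
open scoped ContDiff

namespace DeltaPrime

/-- The complex Hilbert space `L₂(ℝ)`. -/
abbrev L2R : Type := Lp ℂ 2 (volume : Measure ℝ)

/-- The complex Hilbert space `L₂(S)` for a set `S ⊆ ℝ`. -/
abbrev L2On (S : Set ℝ) : Type := Lp ℂ 2 ((volume : Measure ℝ).restrict S)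

/-- Restriction of functions, `L₂(ℝ) → L₂(S)`. -/
noncomputable def restr (S : Set ℝ) : L2R →L[ℂ] L2On S :=
  LpToLpRestrictCLM ℝ ℂ ℂ (volume : Measure ℝ) 2 S

/-- `φ ∈ C₀^∞(U)`: smooth, with compact support contained in `U`. -/
def IsTestFunction (U : Set ℝ) (φ : ℝ → ℂ) : Prop :=
  ContDiff ℝ ∞ φ ∧ HasCompactSupport φ ∧ tsupport φ ⊆ U

/-- `χ ∈ C₀^∞(ℝ)` with `χ' ∈ C₀^∞(ℝ ∖ Γ)`. -/
def IsCutoff (Γ : Set ℝ) (χ : ℝ → ℂ) : Prop :=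
  IsTestFunction univ χ ∧ IsTestFunction Γᶜ (deriv χ)

/-- `A` extends the minimal operator `φ ↦ -φ''`, `φ ∈ C₀^∞(ℝ ∖ Γ)`. -/
def ExtendsMinimal (Γ : Set ℝ) (A : L2R →ₗ.[ℂ] L2R) : Prop :=
  ∀ φ : ℝ → ℂ, IsTestFunction Γᶜ φ → ∀ u v : L2R,
    (u : ℝ → ℂ) =ᵐ[volume] φ →
    (v : ℝ → ℂ) =ᵐ[volume] (fun x => -deriv (deriv φ) x) →
    (u, v) ∈ A.graph

/-- `A` defines a local interaction on `Γ`: its domain is stable under multiplication by every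
cutting function. -/
def IsLocal (Γ : Set ℝ) (A : L2R →ₗ.[ℂ] L2R) : Prop :=
  ∀ u ∈ A.domain, ∀ χ : ℝ → ℂ, IsCutoff Γ χ → ∀ w : L2R,
    (w : ℝ → ℂ) =ᵐ[volume] (fun x => χ x * u x) → w ∈ A.domain

/-- `A` admits splitting boundary conditions at `x₀`: under the decomposition
`L₂(ℝ) = L₂(-∞, x₀) ⊕ L₂(x₀, ∞)` it is the direct sum of two self-adjoint operators. -/
def SplitsAt (A : L2R →ₗ.[ℂ] L2R) (x₀ : ℝ) : Prop :=
  ∃ (A₁ : L2On (Iio x₀) →ₗ.[ℂ] L2On (Iio x₀)) (A₂ : L2On (Ioi x₀) →ₗ.[ℂ] L2On (Ioi x₀)),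
    IsSelfAdjoint A₁ ∧ IsSelfAdjoint A₂ ∧
    ∀ u v : L2R, (u, v) ∈ A.graph ↔
      (restr (Iio x₀) u, restr (Iio x₀) v) ∈ A₁.graph ∧
      (restr (Ioi x₀) u, restr (Ioi x₀) v) ∈ A₂.graph

/-- `A` is a (self-adjoint) Schrödinger operator with `δ'`-interaction on `Γ`. -/
structure IsDeltaPrimeInteraction (Γ : Set ℝ) (A : L2R →ₗ.[ℂ] L2R) : Prop where
  selfAdjoint : IsSelfAdjoint A
  extendsMinimal : ExtendsMinimal Γ A
  isLocal : IsLocal Γ A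
  nonSplitting : ∀ x₀ ∈ Γ, ¬ SplitsAt A x₀
  cutoff_mem : ∀ χ : ℝ → ℂ, IsCutoff Γ χ → ∀ w : L2R,
    (w : ℝ → ℂ) =ᵐ[volume] χ → w ∈ A.domain

/-- `x₀` is an isolated point of `Γ`. -/
def IsIsolatedPoint (Γ : Set ℝ) (x₀ : ℝ) : Prop :=
  x₀ ∈ Γ ∧ ¬ AccPt x₀ (𝓟 Γ)

/-- The boundary conditions of the point `δ'`-interaction of intensity `β` at `x₀`:
`f'(x₀+0) = f'(x₀-0)` and `f(x₀+0) - f(x₀-0) = β (f'(x₀+0) + f'(x₀-0)) / 2`, where the one-sided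
boundary values are required to exist. -/
def DeltaPrimeCondition (f : ℝ → ℂ) (x₀ β : ℝ) : Prop :=
  ∃ a b c d : ℂ,
    Tendsto f (𝓝[>] x₀) (𝓝 a) ∧ Tendsto f (𝓝[<] x₀) (𝓝 b) ∧
    Tendsto (deriv f) (𝓝[>] x₀) (𝓝 c) ∧ Tendsto (deriv f) (𝓝[<] x₀) (𝓝 d) ∧
    c = d ∧ a - b = (β : ℂ) * ((c + d) / 2)

/-- `β` is the intensity of the `δ'`-interaction at the point `x₀`: every function of the domain
(through its representative that is differentiable in a punctured neighbourhood of `x₀`) satisfies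
the boundary conditions with this `β`. -/
def HasIntensity (A : L2R →ₗ.[ℂ] L2R) (x₀ β : ℝ) : Prop :=
  ∀ u ∈ A.domain, ∃ f : ℝ → ℂ, (u : ℝ → ℂ) =ᵐ[volume] f ∧
    (∀ᶠ x in 𝓝[≠] x₀, DifferentiableAt ℝ f x) ∧ DeltaPrimeCondition f x₀ β

/-- The isolated points of `Γ` at which the intensity is negative. -/
def negativeIntensityPoints (Γ : Set ℝ) (A : L2R →ₗ.[ℂ] L2R) : Set ℝ :=
  {x₀ | IsIsolatedPoint Γ x₀ ∧ ∃ β : ℝ, β < 0 ∧ HasIntensity A x₀ β}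

/-- The resolvent set: `A - z` has an everywhere defined bounded inverse `R`. -/
def resolventSet (A : L2R →ₗ.[ℂ] L2R) : Set ℂ :=
  {z | ∃ R : L2R →L[ℂ] L2R,
    (∀ f : L2R, ∃ u : A.domain, (u : L2R) = R f ∧ A u - z • (u : L2R) = f) ∧
    ∀ u : A.domain, R (A u - z • (u : L2R)) = u}

/-- The spectrum of `A`. -/
def spectrumSet (A : L2R →ₗ.[ℂ] L2R) : Set ℂ := (resolventSet A)ᶜ

/-- The kernel of `A - z`, as a subspace of the domain of `A`. -/
noncomputable def eigenspace (A : L2R →ₗ.[ℂ] L2R) (z : ℂ) : Submodule ℂ A.domain :=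
  LinearMap.ker (A.toFun - z • A.domain.subtype)

/-- The negative spectrum of `A` is discrete: each of its points is an isolated point of the
spectrum and an eigenvalue of finite multiplicity. Accumulation at `0` or `-∞` is allowed. -/
def NegativeSpectrumDiscrete (A : L2R →ₗ.[ℂ] L2R) : Prop :=
  ∀ t : ℝ, t < 0 → (t : ℂ) ∈ spectrumSet A →
    ¬ AccPt (t : ℂ) (𝓟 (spectrumSet A)) ∧
    eigenspace A (t : ℂ) ≠ ⊥ ∧ FiniteDimensional ℂ (eigenspace A (t : ℂ))

/-- The number (in `ℕ∞`) of negative eigenvalues of `A`, counted with multiplicity. -/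
noncomputable def numNegativeEigenvalues (A : L2R →ₗ.[ℂ] L2R) : ℕ∞ :=
  ∑' t : Iio (0 : ℝ), Cardinal.toENat (Module.rank ℂ (eigenspace A ((t : ℝ) : ℂ)))

end DeltaPrime

/-
Fix finitely many isolated points `x_k` of `Γ` with intensities `β_k < 0`. Choose smooth
`h_k : ℝ → [0, 1]` with disjoint supports meeting `Γ` at most in `x_k`, `h_k(x_k) = 1` and
`∫ h_k = -β_k`, and let `F_k` be the compactly supported function with derivative `h_k` off `x_k`
and jump `β_k = β_k h_k(x_k)` at `x_k`. Then `F_k ∈ 𝔇(A)`, `A F_k = -h_k'`, and integration by parts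
gives `⟨F_k, A F_k⟩ = ∫ h_k² + β_k < 0`, while `⟨F_j, A F_k⟩ = 0` for `j ≠ k`. A form that is
negative on an `N`-dimensional subspace forces `N` negative eigenvalues: otherwise a nonzero
combination of the `F_k` is orthogonal to all negative eigenvectors, and the functional calculus of
the resolvent makes the form nonnegative there.

That `F_k ∈ 𝔇(A)` follows from `A = A*` once `⟨F_k, A u⟩ = ⟨-h_k', u⟩` for all `u ∈ 𝔇(A)`. Cutting
functions `χ` lie in `𝔇(A)` with `A χ = -χ''`, so the identity holds for `η_δ F_k`, where `η_δ`
vanishes near `x_k` and equals `1` off the ball of radius `2δ`. As `δ → 0` the commutator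
contributes `∫ η_δ' (F_k' u - F_k u')`; the Wronskian is continuous across `x_k` because `F_k` and
`u` satisfy the same `δ'`-condition, `∫ η_δ' = 0` and `∫ |η_δ'|` does not depend on `δ`, so this
term tends to `0`.
-/

namespace DeltaPrime

section BoundedSelfAdjoint

variable {H : Type*} [NormedAddCommGroup H] [InnerProductSpace ℂ H] [CompleteSpace H]

theorem apply_eq_zero_of_orthogonal_ker {W C : H →L[ℂ] H} (hW : IsSelfAdjoint W)
    (hC : Commute C W) {v : H} (hv : ∀ k, W k = 0 → inner ℂ v k = 0) (h : W (C v) = 0) :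
    C v = 0 := by
  have hC' : Commute (star C) W := by
    simpa only [hW.star_eq] using commute_star_star.2 hC
  have hker : W (star C (C v)) = 0 := by
    rw [← mul_apply_eq_comp, ← hC'.eq, mul_apply_eq_comp, h, map_zero]
  have hinner := hv _ hker
  rw [ContinuousLinearMap.star_eq_adjoint, ContinuousLinearMap.adjoint_inner_right] at hinner
  exact inner_self_eq_zero.1 hinner

theorem cfc_apply_eq_zero_of_orthogonal_eigenvectors {R : H →L[ℂ] H} (hR : IsSelfAdjoint R)
    {v : H} (s : Finset ℝ) (hv : ∀ μ ∈ s, ∀ k, R k = (μ : ℂ) • k → inner ℂ v k = 0)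
    {f : ℝ → ℝ} (hf : Continuous f) (h0 : ∀ x ∈ spectrum ℝ R, (∏ μ ∈ s, (x - μ)) * f x = 0) :
    cfc f R v = 0 := by
  induction s using Finset.induction_on generalizing f with
  | empty =>
    have hzero : cfc f R = cfc (fun _ => (0 : ℝ)) R :=
      cfc_congr fun x hx => by simpa using h0 x hx
    rw [hzero, cfc_const_zero, zero_apply]
  | insert a s ha ih =>
    have hsub : cfc (fun x : ℝ => x - a) R = R - algebraMap ℝ _ a := by
      rw [cfc_sub (fun x : ℝ => x) (fun _ => a) R, cfc_id' ℝ R, cfc_const a R]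
    have hmul : cfc (fun x => (x - a) * f x) R v = 0 := by
      refine ih (fun μ hμ => hv μ (Finset.mem_insert_of_mem hμ)) (by fun_prop) fun x hx => ?_
      have := h0 x hx
      rw [Finset.prod_insert ha] at this
      linear_combination this
    rw [cfc_mul (fun x : ℝ => x - a) f R] at hmul
    refine apply_eq_zero_of_orthogonal_ker (cfc_predicate _ R) (cfc_commute_cfc _ _ R)
      (fun k hk => hv a (Finset.mem_insert_self _ _) k ?_) hmul
    rw [hsub, sub_apply, sub_eq_zero] at hk
    rw [hk, Algebra.algebraMap_eq_smul_one]
    simp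

theorem re_inner_nonneg_of_orthogonal_eigenvectors {R : H →L[ℂ] H} (hR : IsSelfAdjoint R)
    {v : H} (s : Finset ℝ) (hs : ∀ x ∈ spectrum ℝ R, x < 0 → x ∈ s)
    (hv : ∀ μ ∈ s, ∀ k, R k = (μ : ℂ) • k → inner ℂ v k = 0) :
    0 ≤ (inner ℂ (R v) v).re := by
  have hdecomp : R = cfc (fun x : ℝ => x⁺) R - cfc (fun x : ℝ => x⁻) R := by
    rw [← cfc_sub (fun x : ℝ => x⁺) (fun x : ℝ => x⁻) R]
    simp only [posPart_sub_negPart, cfc_id' ℝ R]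
  have hneg : cfc (fun x : ℝ => x⁻) R v = 0 := by
    refine cfc_apply_eq_zero_of_orthogonal_eigenvectors hR s hv (by fun_prop) fun x hx => ?_
    rcases lt_or_ge x 0 with h | h
    · rw [Finset.prod_eq_zero (hs x hx h) (sub_self x), zero_mul]
    · rw [negPart_eq_zero.2 h, mul_zero]
  have hpos : 0 ≤ cfc (fun x : ℝ => x⁺) R := cfc_nonneg fun x _ => posPart_nonneg x
  rw [hdecomp, sub_apply, hneg, sub_zero]
  exact ((ContinuousLinearMap.nonneg_iff_isPositive _).1 hpos).re_inner_nonneg_left v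

end BoundedSelfAdjoint

section UnboundedSelfAdjoint

variable {H : Type*} [NormedAddCommGroup H] [InnerProductSpace ℂ H]
  {A : H →ₗ.[ℂ] H} {R S : H →L[ℂ] H} {z μ : ℂ}

/-- `R` is the resolvent `(A - z)⁻¹` of the unbounded operator `A` on a Hilbert space; for
`H = L2R` such an `R` exists exactly when `z ∈ resolventSet A`. -/
structure IsResolventAt (A : H →ₗ.[ℂ] H) (z : ℂ) (R : H →L[ℂ] H) : Prop where
  exists_apply_sub_eq : ∀ f : H, ∃ u : A.domain, (u : H) = R f ∧ A u - z • (u : H) = f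
  apply_sub_eq : ∀ u : A.domain, R (A u - z • (u : H)) = u

theorem mem_resolventSet_iff {A : L2R →ₗ.[ℂ] L2R} :
    z ∈ resolventSet A ↔ ∃ R, IsResolventAt A z R :=
  ⟨fun ⟨R, h₁, h₂⟩ => ⟨R, h₁, h₂⟩, fun ⟨R, h⟩ => ⟨R, h.1, h.2⟩⟩

namespace IsResolventAt

theorem exists_eigenvector (hR : IsResolventAt A z R) (hμ : μ ≠ 0) {k : H} (hk : R k = μ • k) :
    ∃ e : A.domain, (e : H) = k ∧ A e = (z + μ⁻¹) • (e : H) := by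
  obtain ⟨e, he, hAe⟩ := hR.exists_apply_sub_eq k
  have hke : k = μ⁻¹ • (e : H) := by rw [he, hk, inv_smul_smul₀ hμ]
  refine ⟨μ⁻¹ • e, hke.symm, ?_⟩
  rw [LinearPMap.map_smul, sub_eq_iff_eq_add.1 hAe, hke, Submodule.coe_smul]
  module

theorem eq_zero_of_apply_eq (hS : IsResolventAt A z S) {e : A.domain}
    (he : A e = z • (e : H)) : (e : H) = 0 := by
  rw [← hS.apply_sub_eq e, he, sub_self, map_zero]

theorem notMem_spectrum [CompleteSpace H] (hR : IsResolventAt A z R) (hμ : μ ≠ 0)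
    (hS : IsResolventAt A (z + μ⁻¹) S) : μ ∉ spectrum ℂ R := by
  rw [spectrum.notMem_iff, IsUnit.sub_iff, ContinuousLinearMap.isUnit_iff_bijective]
  have happly (v : H) : (R - algebraMap ℂ (H →L[ℂ] H) μ) v = R v - μ • v := by
    simp [Algebra.algebraMap_eq_smul_one]
  refine ⟨(injective_iff_map_eq_zero _).2 fun v hv => ?_, fun w => ?_⟩
  · rw [happly, sub_eq_zero] at hv
    obtain ⟨e, rfl, he⟩ := hR.exists_eigenvector hμ hv
    exact hS.eq_zero_of_apply_eq he
  · obtain ⟨u, -, hAu⟩ := hS.exists_apply_sub_eq w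
    have hshift : A u - z • (u : H) = w + μ⁻¹ • (u : H) := by
      rw [← hAu]
      module
    refine ⟨-μ⁻¹ • (w + μ⁻¹ • (u : H)), ?_⟩
    rw [happly, map_smul, ← hshift, hR.apply_sub_eq, hshift, smul_smul, mul_neg,
      mul_inv_cancel₀ hμ]
    module

end IsResolventAt

variable [CompleteSpace H]

theorem inner_apply_eq_inner_apply (hA : IsSelfAdjoint A) (u v : A.domain) :
    inner ℂ (A u) (v : H) = inner ℂ (u : H) (A v) := by
  have h := LinearPMap.adjoint_isFormalAdjoint hA.dense_domain
  rw [LinearPMap.isSelfAdjoint_def.1 hA] at h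
  exact h u v

theorem mem_graph_of_forall_inner_eq (hA : IsSelfAdjoint A) {g w : H}
    (h : ∀ u : A.domain, inner ℂ w (u : H) = inner ℂ g (A u)) : (g, w) ∈ A.graph := by
  have hdom : g ∈ A.adjoint.domain := LinearPMap.mem_adjoint_domain_of_exists g ⟨w, h⟩
  have hgraph : (g, w) ∈ A.adjoint.graph := (LinearPMap.mem_graph_iff _).2
    ⟨⟨g, hdom⟩, rfl, LinearPMap.adjoint_apply_eq hA.dense_domain ⟨g, hdom⟩ h⟩
  rwa [LinearPMap.isSelfAdjoint_def.1 hA] at hgraph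

theorem IsResolventAt.isSelfAdjoint (hA : IsSelfAdjoint A) {c : ℝ} (hR : IsResolventAt A c R) :
    IsSelfAdjoint R := by
  rw [ContinuousLinearMap.isSelfAdjoint_iff_isSymmetric]
  intro f g
  obtain ⟨u, hu, hAu⟩ := hR.exists_apply_sub_eq f
  obtain ⟨v, hv, hAv⟩ := hR.exists_apply_sub_eq g
  change inner ℂ (R f) g = inner ℂ f (R g)
  rw [← hu, ← hv, ← hAu, ← hAv, inner_sub_left, inner_sub_right, inner_smul_left,
    inner_smul_right, inner_apply_eq_inner_apply hA, Complex.conj_ofReal]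

theorem IsResolventAt.mul_sq_norm_le_re_inner (hA : IsSelfAdjoint A) {c : ℝ} (hc : c ≤ 0)
    (hR : IsResolventAt A c R) {s : Finset ℝ} (hcs : c ∉ s)
    (hs : ∀ t : ℝ, t < 0 → t ∉ s → ∃ S, IsResolventAt A t S) {u : A.domain}
    (hu : ∀ t ∈ s, ∀ e : A.domain, A e = (t : ℂ) • (e : H) → inner ℂ (u : H) (e : H) = 0) :
    c * ‖(u : H)‖ ^ 2 ≤ (inner ℂ (u : H) (A u)).re := by
  have h := re_inner_nonneg_of_orthogonal_eigenvectors (hR.isSelfAdjoint hA)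
    (v := A u - (c : ℂ) • (u : H)) (s.image fun t => (t - c)⁻¹) ?_ ?_
  · rw [hR.apply_sub_eq, inner_sub_right, inner_smul_right, inner_self_eq_norm_sq_to_K,
      Complex.sub_re, Complex.re_ofReal_mul] at h
    exact sub_nonneg.1 (by exact_mod_cast h)
  · intro x hx hx0
    refine Finset.mem_image.2 ⟨c + x⁻¹, ?_, by simp⟩
    by_contra hmem
    obtain ⟨S, hS⟩ := hs _ (by linarith [inv_lt_zero.2 hx0]) hmem
    rw [← spectrum.algebraMap_mem_iff ℂ] at hx
    exact hR.notMem_spectrum (Complex.ofReal_ne_zero.2 hx0.ne) (by simpa using hS) hx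
  · intro μ hμ k hk
    obtain ⟨t, ht, rfl⟩ := Finset.mem_image.1 hμ
    have htc : t - c ≠ 0 := sub_ne_zero.2 fun h => hcs (h ▸ ht)
    obtain ⟨e, rfl, he⟩ := hR.exists_eigenvector (by exact_mod_cast inv_ne_zero htc) hk
    have hAe : A e = (t : ℂ) • (e : H) := by simpa using he
    rw [inner_sub_left, inner_apply_eq_inner_apply hA, hAe, inner_smul_left, inner_smul_right,
      hu t ht e hAe, mul_zero, mul_zero, sub_zero]

theorem re_inner_apply_nonneg_of_orthogonal_eigenvectors (hA : IsSelfAdjoint A) {s : Finset ℝ}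
    (hs : ∀ t : ℝ, t < 0 → t ∉ s → ∃ R, IsResolventAt A t R) {u : A.domain}
    (hu : ∀ t ∈ s, ∀ e : A.domain, A e = (t : ℂ) • (e : H) → inner ℂ (u : H) (e : H) = 0) :
    0 ≤ (inner ℂ (u : H) (A u)).re := by
  -- `0` may lie in the spectrum, so shift to `c < 0` and let `c` increase to `0`.
  have hbound : ∀ᶠ c : ℝ in 𝓝[<] 0, c * ‖(u : H)‖ ^ 2 ≤ (inner ℂ (u : H) (A u)).re := by
    have hmem : ∀ᶠ c : ℝ in 𝓝[<] 0, c ∉ s :=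
      (nhdsLT_le_nhdsNE 0).trans (nhdsNE_le_cofinite 0)
        s.finite_toSet.eventually_cofinite_notMem
    filter_upwards [self_mem_nhdsWithin, hmem] with c hc hcs
    obtain ⟨R, hR⟩ := hs c hc hcs
    exact hR.mul_sq_norm_le_re_inner hA (le_of_lt hc) hcs hs hu
  have hlim : Tendsto (fun c : ℝ => c * ‖(u : H)‖ ^ 2) (𝓝[<] 0) (𝓝 0) :=
    tendsto_nhdsWithin_of_tendsto_nhds (Continuous.tendsto' (by fun_prop) _ _ (zero_mul _))
  exact le_of_tendsto hlim hbound

end UnboundedSelfAdjoint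

section Counting

theorem sum_le_tsum_enat {ι : Type*} (f : ι → ℕ∞) (s : Finset ι) : ∑ i ∈ s, f i ≤ ∑' i, f i :=
  (hasSum_of_isLUB _ isLUB_iSup).summable.sum_le_tsum s fun _ _ => zero_le

theorem finite_support_of_tsum_enat_ne_top {ι : Type*} {f : ι → ℕ∞} (h : ∑' i, f i ≠ ⊤) :
    f.support.Finite := by
  by_contra hinf
  refine h (ENat.eq_top_iff_forall_ge.2 fun n => ?_)
  obtain ⟨s, hs, hcard⟩ := Set.Infinite.exists_subset_card_eq hinf n
  calc (n : ℕ∞) = ∑ _i ∈ s, 1 := by simp [hcard]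
    _ ≤ ∑ i ∈ s, f i := Finset.sum_le_sum fun i hi => Order.one_le_iff_ne_zero.2 (hs hi)
    _ ≤ ∑' i, f i := sum_le_tsum_enat f s

variable {𝕜 H ι κ : Type*} [RCLike 𝕜] [NormedAddCommGroup H] [InnerProductSpace 𝕜 H] [Fintype ι]

theorem exists_linearCombination_orthogonal [Fintype κ] (E : κ → Submodule 𝕜 H)
    [∀ t, FiniteDimensional 𝕜 (E t)] (f : ι → H)
    (hcard : ∑ t, Module.finrank 𝕜 (E t) < Fintype.card ι) :
    ∃ a : ι → 𝕜, a ≠ 0 ∧ ∀ t, ∀ e ∈ E t, inner 𝕜 (∑ k, a k • f k) e = 0 := by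
  let P : (ι → 𝕜) →ₗ[𝕜] ((t : κ) → E t) := LinearMap.pi fun t =>
    (E t).orthogonalProjectionOnto.toLinearMap ∘ₗ Fintype.linearCombination 𝕜 f
  have hker : LinearMap.ker P ≠ ⊥ := LinearMap.ker_ne_bot_of_finrank_lt <| by
    rwa [Module.finrank_pi_fintype, Module.finrank_fintype_fun_eq_card]
  obtain ⟨a, ha, ha0⟩ := Submodule.exists_mem_ne_zero_of_ne_bot hker
  refine ⟨a, ha0, fun t e he => Submodule.inner_left_of_mem_orthogonal he ?_⟩
  rw [← Submodule.orthogonalProjectionOnto_eq_zero_iff]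
  exact congrFun (LinearMap.mem_ker.1 ha) t

theorem inner_sum_smul_apply_sum_smul {A : H →ₗ.[𝕜] H} {f : ι → A.domain}
    (horth : Pairwise fun j k => inner 𝕜 (f j : H) (A (f k)) = 0) (a : ι → 𝕜) :
    inner 𝕜 ((∑ k, a k • f k : A.domain) : H) (A (∑ k, a k • f k)) =
      ∑ k, ((‖a k‖ ^ 2 : ℝ) : 𝕜) * inner 𝕜 (f k : H) (A (f k)) := by
  classical
  have hA : A (∑ k, a k • f k) = ∑ k, a k • A (f k) := by
    simp only [← LinearPMap.toFun_eq_coe, map_sum, map_smul]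
  rw [hA, Submodule.coe_sum, sum_inner]
  refine Finset.sum_congr rfl fun j _ => ?_
  rw [inner_sum, Finset.sum_eq_single j (fun k _ hk => ?_) (by simp), Submodule.coe_smul,
    inner_smul_left, inner_smul_right, ← mul_assoc, RCLike.conj_mul, RCLike.ofReal_pow]
  rw [Submodule.coe_smul, inner_smul_left, inner_smul_right, horth hk.symm, mul_zero, mul_zero]

end Counting

theorem mem_eigenspace_iff {A : L2R →ₗ.[ℂ] L2R} {z : ℂ} {u : A.domain} :
    u ∈ eigenspace A z ↔ A u = z • (u : L2R) := by
  rw [eigenspace, LinearMap.mem_ker, LinearMap.sub_apply, sub_eq_zero]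
  rfl

theorem exists_finset_sum_finrank_eigenspace_lt {A : L2R →ₗ.[ℂ] L2R} {N : ℕ}
    (hlt : numNegativeEigenvalues A < N) :
    ∃ s : Finset ℝ, (∀ t : ℝ, t < 0 → eigenspace A (t : ℂ) ≠ ⊥ → t ∈ s) ∧
      (∀ t ∈ s, FiniteDimensional ℂ (eigenspace A (t : ℂ))) ∧
      ∑ t ∈ s, Module.finrank ℂ (eigenspace A (t : ℂ)) < N := by
  set f : Iio (0 : ℝ) → ℕ∞ := fun t =>
    Cardinal.toENat (Module.rank ℂ (eigenspace A ((t : ℝ) : ℂ)))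
  have htop (t) : f t ≠ ⊤ := ne_top_of_le_ne_top hlt.ne_top <|
    (Finset.sum_singleton f t).ge.trans (sum_le_tsum_enat f {t})
  have hfin (t : Iio (0 : ℝ)) : FiniteDimensional ℂ (eigenspace A ((t : ℝ) : ℂ)) := by
    rw [FiniteDimensional, ← Module.rank_lt_aleph0_iff, ← Cardinal.toENat_lt_top]
    exact (htop t).lt_top
  have hrank (t) : f t = Module.finrank ℂ (eigenspace A ((t : ℝ) : ℂ)) := by
    have := hfin t
    rw [← Cardinal.toENat_nat, Module.finrank_eq_rank]
  set s := (finite_support_of_tsum_enat_ne_top hlt.ne_top).toFinset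
  refine ⟨s.map (Function.Embedding.subtype _), fun t ht hne => ?_, fun t ht => ?_, ?_⟩
  · have := hfin ⟨t, ht⟩
    have hft : f ⟨t, ht⟩ ≠ 0 := by
      rw [hrank, Nat.cast_ne_zero, Ne, Submodule.finrank_eq_zero]
      exact hne
    exact Finset.mem_map.2 ⟨⟨t, ht⟩, (Set.Finite.mem_toFinset _).2 hft, rfl⟩
  · obtain ⟨t, -, rfl⟩ := Finset.mem_map.1 ht
    exact hfin t
  · rw [Finset.sum_map, ← Nat.cast_lt (α := ℕ∞), Nat.cast_sum]
    exact (Finset.sum_congr rfl fun t _ => (hrank t).symm).trans_lt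
      ((sum_le_tsum_enat f s).trans_lt hlt)

theorem card_le_numNegativeEigenvalues {A : L2R →ₗ.[ℂ] L2R} (hA : IsSelfAdjoint A)
    (hσ : ∀ t : ℝ, t < 0 → (t : ℂ) ∈ spectrumSet A → eigenspace A (t : ℂ) ≠ ⊥)
    {ι : Type*} [Fintype ι] (f : ι → A.domain)
    (horth : Pairwise fun j k => inner ℂ (f j : L2R) (A (f k)) = 0)
    (hneg : ∀ k, (inner ℂ (f k : L2R) (A (f k))).re < 0) :
    (Fintype.card ι : ℕ∞) ≤ numNegativeEigenvalues A := by
  by_contra! hlt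
  obtain ⟨s, hmem, hfin, hsum⟩ := exists_finset_sum_finrank_eigenspace_lt hlt
  let E (t : s) : Submodule ℂ L2R := (eigenspace A ((t : ℝ) : ℂ)).map A.domain.subtype
  have (t : s) : FiniteDimensional ℂ (eigenspace A ((t : ℝ) : ℂ)) := hfin t t.2
  have hcard : ∑ t, Module.finrank ℂ (E t) < Fintype.card ι := by
    rw [← Finset.sum_coe_sort] at hsum
    exact (Finset.sum_le_sum fun t _ => Submodule.finrank_map_le _ _).trans_lt hsum
  obtain ⟨a, ha0, ha⟩ := exists_linearCombination_orthogonal E (fun k => (f k : L2R)) hcard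
  have hnonneg : 0 ≤ (inner ℂ ((∑ k, a k • f k : A.domain) : L2R) (A (∑ k, a k • f k))).re := by
    refine re_inner_apply_nonneg_of_orthogonal_eigenvectors hA (s := s) (fun t ht hts => ?_)
      fun t ht e he => ?_
    · rw [← mem_resolventSet_iff]
      by_contra h
      exact hts (hmem t ht (hσ t ht h))
    · rw [Submodule.coe_sum]
      exact ha ⟨t, ht⟩ e (Submodule.mem_map_of_mem (mem_eigenspace_iff.2 he))
  rw [inner_sum_smul_apply_sum_smul horth, Complex.re_sum] at hnonneg
  obtain ⟨k, hk⟩ := Function.ne_iff.1 ha0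
  refine hnonneg.not_gt (Finset.sum_neg' (fun j _ => ?_) ⟨k, Finset.mem_univ k, ?_⟩)
  · exact (RCLike.re_ofReal_mul (K := ℂ) _ _).trans_le
      (mul_nonpos_of_nonneg_of_nonpos (sq_nonneg _) (hneg j).le)
  · exact (RCLike.re_ofReal_mul (K := ℂ) _ _).trans_lt
      (mul_neg_of_pos_of_neg (pow_pos (norm_pos_iff.2 hk) 2) (hneg k))

section SquareIntegrable

variable {α : Type*} [MeasurableSpace α] {μ : Measure α} {G : α → ℝ} {w : Lp ℂ 2 μ}

theorem exists_ae_eq_ofReal (hG : MemLp G 2 μ) : ∃ w : Lp ℂ 2 μ, w =ᵐ[μ] fun x => (G x : ℂ) :=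
  ⟨hG.ofReal.toLp, hG.ofReal.coeFn_toLp⟩

theorem inner_eq_integral_smul (hw : w =ᵐ[μ] fun x => (G x : ℂ)) (u : Lp ℂ 2 μ) :
    inner ℂ w u = ∫ x, G x • u x ∂μ := by
  rw [L2.inner_def]
  refine integral_congr_ae (hw.mono fun x hx => ?_)
  simp only [hx, RCLike.inner_apply, Complex.conj_ofReal, mul_comm, Complex.real_smul]

theorem integrable_smul_coeFn (hG : MemLp G 2 μ) (u : Lp ℂ 2 μ) :
    Integrable (fun x => G x • u x) μ :=
  memLp_one_iff_integrable.1 ((Lp.memLp u).smul hG)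

end SquareIntegrable

section IntegrationByParts

variable {E : Type*} [NormedAddCommGroup E] [NormedSpace ℝ E] {e : ℝ → ℝ} {g : ℝ → E}

theorem norm_smul_le_of_norm_le_on_tsupport {C : ℝ} (hC : ∀ x ∈ tsupport e, ‖g x‖ ≤ C) (x : ℝ) :
    ‖e x • g x‖ ≤ C * |e x| := by
  rw [norm_smul, mul_comm, Real.norm_eq_abs]
  by_cases hx : x ∈ tsupport e
  · gcongr
    exact hC x hx
  · simp [image_eq_zero_of_notMem_tsupport hx]

theorem integrable_smul_of_norm_le_on_tsupport (he : Continuous e) (hs : HasCompactSupport e)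
    (hg : AEStronglyMeasurable g volume) {C : ℝ} (hC : ∀ x ∈ tsupport e, ‖g x‖ ≤ C) :
    Integrable fun x => e x • g x :=
  ((he.integrable_of_hasCompactSupport hs).abs.const_mul C).mono'
    (he.aestronglyMeasurable.smul hg) (ae_of_all _ (norm_smul_le_of_norm_le_on_tsupport hC))

theorem norm_integral_smul_le_of_norm_le_on_tsupport (he : Integrable e) {C : ℝ}
    (hC : ∀ x ∈ tsupport e, ‖g x‖ ≤ C) : ‖∫ x, e x • g x‖ ≤ C * ∫ x, |e x| := by
  rw [← integral_const_mul]
  exact norm_integral_le_of_norm_le (he.abs.const_mul C)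
    (ae_of_all _ (norm_smul_le_of_norm_le_on_tsupport hC))

theorem integral_deriv_smul_eq_neg [CompleteSpace E] (he : ContDiff ℝ 1 e)
    (hs : HasCompactSupport e) (hg : ∀ x ∈ tsupport e, DifferentiableAt ℝ g x)
    (hint : Integrable fun x => e x • deriv g x) :
    ∫ x, deriv e x • g x = -∫ x, e x • deriv g x := by
  have hderiv (x : ℝ) : HasDerivAt (fun x => e x • g x) (e x • deriv g x + deriv e x • g x) x := by
    by_cases hx : x ∈ tsupport e
    · exact (he.differentiable one_ne_zero x).hasDerivAt.smul (hg x hx).hasDerivAt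
    · rw [image_eq_zero_of_notMem_tsupport hx, deriv_of_notMem_tsupport hx, zero_smul, zero_smul,
        add_zero]
      exact .of_notMem_tsupport fun h => hx (tsupport_smul_subset_left e g h)
  have hcont : Continuous fun x => e x • g x :=
    continuous_iff_continuousAt.2 fun x => (hderiv x).continuousAt
  have hcont' : Continuous fun x => deriv e x • g x :=
    continuous_of_tsupport fun x hx => (he.continuous_deriv le_rfl).continuousAt.smul
      (hg x (tsupport_deriv_subset (tsupport_smul_subset_left _ g hx))).continuousAt
  have hint' : Integrable fun x => deriv e x • g x :=
    hcont'.integrable_of_hasCompactSupport hs.deriv.smul_right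
  have hzero := integral_eq_zero_of_hasDerivAt_of_integrable hderiv (hint.add hint')
    (hcont.integrable_of_hasCompactSupport hs.smul_right)
  rw [integral_add hint hint'] at hzero
  exact eq_neg_of_add_eq_zero_right hzero

theorem integral_deriv_deriv_smul [CompleteSpace E] (he : ContDiff ℝ 2 e)
    (hs : HasCompactSupport e) (hg : ContDiff ℝ 2 g) :
    ∫ x, deriv (deriv e) x • g x = ∫ x, e x • deriv (deriv g) x := by
  have he' : ContDiff ℝ 1 (deriv e) := (contDiff_succ_iff_deriv (n := 1)).1 he |>.2.2
  have hg' : ContDiff ℝ 1 (deriv g) := (contDiff_succ_iff_deriv (n := 1)).1 hg |>.2.2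
  rw [integral_deriv_smul_eq_neg he' hs.deriv
      (fun x _ => hg.differentiable two_ne_zero x)
      ((he'.continuous.smul hg'.continuous).integrable_of_hasCompactSupport hs.deriv.smul_right),
    integral_deriv_smul_eq_neg (he.of_le one_le_two) hs
      (fun x _ => hg'.differentiable one_ne_zero x)
      ((he.continuous.smul (hg'.continuous_deriv le_rfl)).integrable_of_hasCompactSupport
        hs.smul_right), neg_neg]

end IntegrationByParts

section TestFunctions

theorem deriv_ofReal_comp {G : ℝ → ℝ} (hG : Differentiable ℝ G) :
    (deriv fun x => (G x : ℂ)) = fun x => ((deriv G x : ℝ) : ℂ) :=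
  funext fun x => (hG x).hasDerivAt.ofReal_comp.deriv

theorem deriv_deriv_ofReal_comp {G : ℝ → ℝ} (hG : ContDiff ℝ 2 G) :
    (deriv (deriv fun x => (G x : ℂ))) = fun x => ((deriv (deriv G) x : ℝ) : ℂ) := by
  rw [deriv_ofReal_comp (hG.differentiable two_ne_zero),
    deriv_ofReal_comp ((hG.deriv' (n := 1)).differentiable one_ne_zero)]

theorem isTestFunction_ofReal {U : Set ℝ} {G : ℝ → ℝ} (hG : ContDiff ℝ ∞ G)
    (hs : HasCompactSupport G) (hU : tsupport G ⊆ U) : IsTestFunction U fun x => (G x : ℂ) := by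
  refine ⟨Complex.ofRealCLM.contDiff.comp hG, hs.comp_left Complex.ofReal_zero, ?_⟩
  exact (closure_mono (Function.support_comp_subset Complex.ofReal_zero G)).trans hU

theorem isCutoff_ofReal {Γ : Set ℝ} {G : ℝ → ℝ} (hG : ContDiff ℝ ∞ G)
    (hs : HasCompactSupport G) (hΓ : tsupport (deriv G) ⊆ Γᶜ) : IsCutoff Γ fun x => (G x : ℂ) := by
  refine ⟨isTestFunction_ofReal hG hs (subset_univ _), ?_⟩
  rw [deriv_ofReal_comp (hG.differentiable (by simp))]
  exact isTestFunction_ofReal (contDiff_infty_iff_deriv.1 hG).2 hs.deriv hΓ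

end TestFunctions

section Excision

variable {x₀ δ : ℝ}

/-- A smooth function on `ℝ` that is `1` on `[-1, 1]` and vanishes outside `[-2, 2]`. -/
noncomputable def unitBump : ContDiffBump (0 : ℝ) := ⟨1, 2, one_pos, one_lt_two⟩

/-- A smooth function that vanishes near `x₀` and equals `1` outside `[x₀ - 2δ, x₀ + 2δ]`, for
`δ > 0`. It is a rescaling of a fixed profile, so its derivative has an `L₁` norm independent of
`δ`. -/
noncomputable def excision (x₀ δ x : ℝ) : ℝ := 1 - unitBump (δ⁻¹ * (x - x₀))

theorem contDiff_excision (x₀ δ : ℝ) : ContDiff ℝ ∞ (excision x₀ δ) :=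
  contDiff_const.sub (unitBump.contDiff.comp (by fun_prop))

theorem excision_eventuallyEq_zero (x₀ δ : ℝ) : excision x₀ δ =ᶠ[𝓝 x₀] 0 := by
  have hlim : Tendsto (fun x => δ⁻¹ * (x - x₀)) (𝓝 x₀) (𝓝 0) :=
    Continuous.tendsto' (by fun_prop) _ _ (by simp)
  filter_upwards [hlim.eventually unitBump.eventuallyEq_one] with x hx
  rw [excision, hx, Pi.one_apply, sub_self, Pi.zero_apply]

theorem excision_eq_one (hδ : 0 < δ) {x : ℝ} (hx : 2 * δ ≤ dist x x₀) : excision x₀ δ x = 1 := by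
  rw [excision, unitBump.zero_of_le_dist, sub_zero]
  rw [Real.dist_eq, sub_zero, abs_mul, abs_of_pos (inv_pos.2 hδ), ← Real.dist_eq,
    ← div_eq_inv_mul, le_div_iff₀ hδ]
  exact hx

theorem abs_excision_le_one (x₀ δ x : ℝ) : |excision x₀ δ x| ≤ 1 := by
  rw [excision, abs_of_nonneg (sub_nonneg.2 unitBump.le_one)]
  exact sub_le_self _ unitBump.nonneg

theorem tsupport_deriv_excision_subset (hδ : 0 < δ) :
    tsupport (deriv (excision x₀ δ)) ⊆ Metric.closedBall x₀ (2 * δ) \ {x₀} := by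
  refine subset_sdiff_singleton ?_ ?_
  · have hderiv : deriv (excision x₀ δ) = deriv fun x => excision x₀ δ x - 1 :=
      funext fun x => (deriv_sub_const 1).symm
    rw [hderiv]
    refine tsupport_deriv_subset.trans (closure_minimal (fun x hx => ?_) Metric.isClosed_closedBall)
    by_contra hdist
    exact hx (sub_eq_zero.2 (excision_eq_one hδ (not_le.1 hdist).le))
  · rw [notMem_tsupport_iff_eventuallyEq]
    exact (excision_eventuallyEq_zero x₀ δ).deriv.trans (by simp)

theorem eventually_tsupport_deriv_excision_subset {s : Set ℝ} (hs : s ∈ 𝓝[≠] x₀) :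
    ∀ᶠ δ in 𝓝[>] 0, tsupport (deriv (excision x₀ δ)) ⊆ s := by
  obtain ⟨r, hr, hball⟩ := Metric.mem_nhdsWithin_iff.1 hs
  filter_upwards [self_mem_nhdsWithin, nhdsWithin_le_nhds (eventually_lt_nhds (half_pos hr))]
    with δ hδ hδr
  refine (tsupport_deriv_excision_subset hδ).trans fun x hx => hball ⟨?_, hx.2⟩
  exact (Metric.mem_closedBall.1 hx.1).trans_lt (by linarith)

theorem hasCompactSupport_deriv_excision (hδ : 0 < δ) :
    HasCompactSupport (deriv (excision x₀ δ)) :=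
  (isCompact_closedBall x₀ (2 * δ)).of_isClosed_subset (isClosed_tsupport _)
    ((tsupport_deriv_excision_subset hδ).trans sdiff_subset)

theorem continuous_deriv_excision (x₀ δ : ℝ) : Continuous (deriv (excision x₀ δ)) :=
  (contDiff_infty_iff_deriv.1 (contDiff_excision x₀ δ)).2.continuous

theorem integrable_deriv_excision (hδ : 0 < δ) : Integrable (deriv (excision x₀ δ)) :=
  (continuous_deriv_excision x₀ δ).integrable_of_hasCompactSupport
    (hasCompactSupport_deriv_excision hδ)

theorem integral_deriv_excision (hδ : 0 < δ) : ∫ x, deriv (excision x₀ δ) x = 0 := by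
  have hdiff := (contDiff_excision x₀ δ).differentiable (by simp)
  have hone : ∀ᶠ x in cocompact ℝ, excision x₀ δ x = 1 := by
    filter_upwards [(isCompact_closedBall x₀ (2 * δ)).compl_mem_cocompact] with x hx
    exact excision_eq_one hδ (not_le.1 (Metric.mem_closedBall.not.1 hx)).le
  have hlim : Tendsto (excision x₀ δ) (cocompact ℝ) (𝓝 1) := tendsto_nhds_of_eventually_eq hone
  rw [integral_of_hasDerivAt_of_tendsto (fun x => (hdiff x).hasDerivAt)
    (integrable_deriv_excision hδ) (hlim.mono_left atBot_le_cocompact)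
    (hlim.mono_left atTop_le_cocompact), sub_self]

theorem integral_abs_deriv_excision (hδ : 0 < δ) :
    ∫ x, |deriv (excision x₀ δ) x| = ∫ x, |deriv unitBump x| := by
  have hderiv (x : ℝ) : |deriv (excision x₀ δ) x| = δ⁻¹ * |deriv unitBump (δ⁻¹ * (x - x₀))| := by
    unfold excision
    rw [deriv_const_sub, deriv_comp_sub_const (f := fun y => unitBump (δ⁻¹ * y)),
      deriv_comp_mul_left, smul_eq_mul, abs_neg, abs_mul, abs_of_pos (inv_pos.2 hδ)]
  simp only [hderiv]
  rw [integral_const_mul,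
    integral_sub_right_eq_self (fun x => |deriv unitBump (δ⁻¹ * x)|) x₀,
    Measure.integral_comp_mul_left (fun x => |deriv unitBump x|), inv_inv,
    abs_of_pos hδ, smul_eq_mul, inv_mul_cancel_left₀ hδ.ne']

variable {E : Type*} [NormedAddCommGroup E] [NormedSpace ℝ E] {g : ℝ → E}

theorem tendsto_integral_excision_smul (hg : Integrable g) (x₀ : ℝ) :
    Tendsto (fun δ => ∫ x, excision x₀ δ x • g x) (𝓝[>] 0) (𝓝 (∫ x, g x)) := by
  refine tendsto_integral_filter_of_dominated_convergence (fun x => ‖g x‖)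
    (Eventually.of_forall fun δ => (contDiff_excision x₀ δ).continuous.aestronglyMeasurable.smul
      hg.aestronglyMeasurable) (Eventually.of_forall fun δ => ae_of_all _ fun x => ?_) hg.norm ?_
  · rw [norm_smul, Real.norm_eq_abs]
    exact mul_le_of_le_one_left (norm_nonneg _) (abs_excision_le_one x₀ δ x)
  · filter_upwards [Measure.ae_ne volume x₀] with x hx
    have hsmall : ∀ᶠ δ : ℝ in 𝓝[>] 0, δ < dist x x₀ / 2 :=
      nhdsWithin_le_nhds (eventually_lt_nhds (half_pos (dist_pos.2 hx)))
    refine tendsto_nhds_of_eventually_eq ?_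
    filter_upwards [self_mem_nhdsWithin, hsmall] with δ hδ hδx
    rw [excision_eq_one hδ (by linarith), one_smul]

theorem tendsto_integral_deriv_excision_smul [CompleteSpace E]
    (hg : AEStronglyMeasurable g volume) {l : E} (hl : Tendsto g (𝓝[≠] x₀) (𝓝 l)) :
    Tendsto (fun δ => ∫ x, deriv (excision x₀ δ) x • g x) (𝓝[>] 0) (𝓝 0) := by
  set K := ∫ x, |deriv unitBump x|
  have hK : 0 < K + 1 :=
    add_pos_of_nonneg_of_pos (integral_nonneg fun _ => abs_nonneg _) one_pos
  rw [Metric.tendsto_nhds]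
  intro ε hε
  have hclose : ∀ᶠ x in 𝓝[≠] x₀, dist (g x) l < ε / (K + 1) :=
    Metric.tendsto_nhds.1 hl _ (div_pos hε hK)
  filter_upwards [self_mem_nhdsWithin, eventually_tsupport_deriv_excision_subset hclose]
    with δ hδ hsupp
  have hbound (x) (hx : x ∈ tsupport (deriv (excision x₀ δ))) : ‖g x - l‖ ≤ ε / (K + 1) :=
    dist_eq_norm (g x) l ▸ (hsupp hx).le
  have hint : Integrable fun x => deriv (excision x₀ δ) x • (g x - l) :=
    integrable_smul_of_norm_le_on_tsupport (continuous_deriv_excision x₀ δ)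
      (hasCompactSupport_deriv_excision hδ) (hg.sub aestronglyMeasurable_const) hbound
  have hcenter : ∫ x, deriv (excision x₀ δ) x • g x
      = ∫ x, deriv (excision x₀ δ) x • (g x - l) := by
    rw [← add_zero (∫ x, _ • (g x - l)), ← zero_smul ℝ l, ← integral_deriv_excision (x₀ := x₀) hδ,
      ← integral_smul_const, ← integral_add hint ((integrable_deriv_excision hδ).smul_const l)]
    simp only [← smul_add, sub_add_cancel]
  rw [dist_zero_right, hcenter]
  calc ‖∫ x, deriv (excision x₀ δ) x • (g x - l)‖
      ≤ ε / (K + 1) * ∫ x, |deriv (excision x₀ δ) x| :=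
        norm_integral_smul_le_of_norm_le_on_tsupport (integrable_deriv_excision hδ) hbound
    _ = ε * (K / (K + 1)) := by rw [integral_abs_deriv_excision hδ]; ring
    _ < ε := mul_lt_of_lt_one_right hε ((div_lt_one hK).2 (lt_add_one K))

theorem eventually_integrable_deriv_excision_smul (hg : AEStronglyMeasurable g volume)
    (hb : g =O[𝓝[≠] x₀] fun _ => (1 : ℝ)) :
    ∀ᶠ δ in 𝓝[>] 0, Integrable fun x => deriv (excision x₀ δ) x • g x := by
  obtain ⟨C, hC⟩ := hb.bound
  filter_upwards [self_mem_nhdsWithin, eventually_tsupport_deriv_excision_subset hC] with δ hδ hsupp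
  exact integrable_smul_of_norm_le_on_tsupport (continuous_deriv_excision x₀ δ)
    (hasCompactSupport_deriv_excision hδ) hg (C := C) fun x hx => by simpa using hsupp hx

end Excision

section Wronskian

variable {f g : ℝ → ℂ} {x₀ β : ℝ}

theorem DeltaPrimeCondition.isBigO_one (hf : DeltaPrimeCondition f x₀ β) :
    f =O[𝓝[≠] x₀] fun _ => (1 : ℝ) := by
  obtain ⟨a, b, c, d, ha, hb, -⟩ := hf
  rw [← nhdsLT_sup_nhdsGT]
  exact (hb.isBigO_one ℝ).sup (ha.isBigO_one ℝ)

theorem DeltaPrimeCondition.isBigO_deriv_one (hf : DeltaPrimeCondition f x₀ β) :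
    deriv f =O[𝓝[≠] x₀] fun _ => (1 : ℝ) := by
  obtain ⟨a, b, c, d, -, -, hc, hd, -⟩ := hf
  rw [← nhdsLT_sup_nhdsGT]
  exact (hd.isBigO_one ℝ).sup (hc.isBigO_one ℝ)

theorem DeltaPrimeCondition.exists_tendsto_wronskian (hf : DeltaPrimeCondition f x₀ β)
    (hg : DeltaPrimeCondition g x₀ β) :
    ∃ l, Tendsto (fun x => deriv f x * g x - f x * deriv g x) (𝓝[≠] x₀) (𝓝 l) := by
  obtain ⟨a, b, c, _, ha, hb, hc, hd, rfl, hab⟩ := hf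
  obtain ⟨a', b', c', _, ha', hb', hc', hd', rfl, hab'⟩ := hg
  refine ⟨c * a' - a * c', ?_⟩
  have hjump : c * b' - b * c' = c * a' - a * c' := by linear_combination c' * hab - c * hab'
  rw [← nhdsLT_sup_nhdsGT]
  exact (hjump ▸ (hd.mul hb').sub (hb.mul hd')).sup ((hc.mul ha').sub (ha.mul hc'))

theorem integral_deriv_smul_mul_add {e : ℝ → ℝ} (he : ContDiff ℝ 1 e) (hs : HasCompactSupport e)
    (hf : ∀ x ∈ tsupport e, DifferentiableAt ℝ f x) (hg : ∀ x ∈ tsupport e, DifferentiableAt ℝ g x)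
    (hint : Integrable fun x => e x • (deriv f x * g x))
    (hint' : Integrable fun x => e x • (f x * deriv g x)) :
    ∫ x, (deriv e x • (f x * g x) + 2 * e x • (deriv f x * g x))
      = ∫ x, e x • (deriv f x * g x - f x * deriv g x) := by
  have hderiv : (fun x => e x • deriv (fun x => f x * g x) x)
      = fun x => e x • (deriv f x * g x) + e x • (f x * deriv g x) := by
    ext x
    by_cases hx : x ∈ tsupport e
    · rw [deriv_fun_mul (hf x hx) (hg x hx), smul_add]
    · simp [image_eq_zero_of_notMem_tsupport hx]
  have hparts := integral_deriv_smul_eq_neg he hs (fun x hx => (hf x hx).fun_mul (hg x hx))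
    (hderiv ▸ hint.add hint')
  have hcont : Continuous fun x => deriv e x • (f x * g x) :=
    continuous_of_tsupport fun x hx => (he.continuous_deriv le_rfl).continuousAt.smul
      ((hf x (tsupport_deriv_subset (tsupport_smul_subset_left _ _ hx))).continuousAt.mul
        (hg x (tsupport_deriv_subset (tsupport_smul_subset_left _ _ hx))).continuousAt)
  rw [integral_add (hcont.integrable_of_hasCompactSupport hs.deriv.smul_right) (hint.const_mul 2),
    hparts, hderiv, integral_add hint hint', integral_const_mul]
  simp only [smul_sub]
  rw [integral_sub hint hint']
  ring

end Wronskian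

section Excising

variable {Γ : Set ℝ} {F h η : ℝ → ℝ} {x₀ : ℝ}

theorem hasDerivAt_mul_of_eventuallyEq_zero (hF : ∀ x ≠ x₀, HasDerivAt F (h x) x)
    (hη : Differentiable ℝ η) (hη₀ : η =ᶠ[𝓝 x₀] 0) (x : ℝ) :
    HasDerivAt (fun x => η x * F x) (deriv η x * F x + η x * h x) x := by
  obtain rfl | hx := eq_or_ne x x₀
  · have hzero : (fun x => η x * F x) =ᶠ[𝓝 x] fun _ => 0 := hη₀.mono fun y hy => by simp [hy]
    simpa [hη₀.deriv_eq, hη₀.eq_of_nhds] using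
      (hasDerivAt_const x (0 : ℝ)).congr_of_eventuallyEq hzero
  · exact (hη x).hasDerivAt.mul (hF x hx)

theorem contDiff_mul_of_eventuallyEq_zero (hF : ∀ x ≠ x₀, HasDerivAt F (h x) x)
    (hh : ContDiff ℝ ∞ h) (hη : ContDiff ℝ ∞ η) (hη₀ : η =ᶠ[𝓝 x₀] 0) :
    ContDiff ℝ ∞ fun x => η x * F x := by
  have hFsmooth : ContDiffOn ℝ ∞ F {x₀}ᶜ :=
    (contDiffOn_infty_iff_deriv_of_isOpen isOpen_compl_singleton).2
      ⟨fun x hx => (hF x hx).differentiableAt.differentiableWithinAt,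
        hh.contDiffOn.congr fun x hx => (hF x hx).deriv⟩
  refine contDiff_iff_contDiffAt.2 fun x => ?_
  obtain rfl | hx := eq_or_ne x x₀
  · exact (contDiffAt_const (c := 0)).congr_of_eventuallyEq (hη₀.mono fun y hy => by simp [hy])
  · exact hη.contDiffAt.mul (hFsmooth.contDiffAt (isOpen_compl_singleton.mem_nhds hx))

theorem deriv_mul_of_eventuallyEq_zero (hF : ∀ x ≠ x₀, HasDerivAt F (h x) x)
    (hη : Differentiable ℝ η) (hη₀ : η =ᶠ[𝓝 x₀] 0) :
    (deriv fun x => η x * F x) = fun x => deriv η x * F x + η x * h x :=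
  funext fun x => (hasDerivAt_mul_of_eventuallyEq_zero hF hη hη₀ x).deriv

theorem deriv_deriv_mul_of_eventuallyEq_zero (hF : ∀ x ≠ x₀, HasDerivAt F (h x) x)
    (hh : Differentiable ℝ h) (hη : ContDiff ℝ 2 η) (hη₀ : η =ᶠ[𝓝 x₀] 0) :
    (deriv (deriv fun x => η x * F x))
      = fun x => deriv (deriv η) x * F x + 2 * (deriv η x * h x) + η x * deriv h x := by
  have hη' : Differentiable ℝ (deriv η) := (hη.deriv' (n := 1)).differentiable one_ne_zero
  have hη₀' : deriv η =ᶠ[𝓝 x₀] 0 := hη₀.deriv.trans (by simp)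
  rw [deriv_mul_of_eventuallyEq_zero hF (hη.differentiable two_ne_zero) hη₀]
  ext x
  rw [((hasDerivAt_mul_of_eventuallyEq_zero hF hη' hη₀' x).fun_add
    ((hη.differentiable two_ne_zero x).hasDerivAt.fun_mul (hh x).hasDerivAt)).deriv]
  ring

theorem tsupport_deriv_mul_subset (hF : ∀ x ≠ x₀, HasDerivAt F (h x) x) (hη : Differentiable ℝ η)
    (hη₀ : η =ᶠ[𝓝 x₀] 0) (hhΓ : Γ ∩ tsupport h ⊆ {x₀}) (hηΓ : tsupport (deriv η) ⊆ Γᶜ) :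
    tsupport (deriv fun x => η x * F x) ⊆ Γᶜ := by
  rw [deriv_mul_of_eventuallyEq_zero hF hη hη₀]
  refine (tsupport_add _ _).trans (union_subset ((tsupport_mul_subset_left).trans hηΓ) ?_)
  intro x hx hxΓ
  obtain rfl := hhΓ ⟨hxΓ, tsupport_mul_subset_right hx⟩
  exact notMem_tsupport_iff_eventuallyEq.2 hη₀ (tsupport_mul_subset_left hx)

end Excising

section SinglePoint

variable {Γ : Set ℝ} {F h : ℝ → ℝ} {x₀ β : ℝ}

/-- `F` is a compactly supported real function, smooth off `x₀`, whose derivative `h` extends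
smoothly across `x₀`; it satisfies the boundary conditions of intensity `β` at `x₀` and is locally
constant near the other points of `Γ`. If `x₀` is an isolated point of `Γ` with intensity `β`, such
an `F` lies in the domain of the operator, which maps it to `-h'`. -/
structure IsSinglePointTestFunction (Γ : Set ℝ) (x₀ β : ℝ) (F h : ℝ → ℝ) : Prop where
  contDiff : ContDiff ℝ ∞ h
  hasCompactSupport_deriv : HasCompactSupport h
  hasCompactSupport : HasCompactSupport F
  memLp : MemLp F 2 volume
  hasDerivAt : ∀ x ≠ x₀, HasDerivAt F (h x) x
  inter_tsupport_subset : Γ ∩ tsupport h ⊆ {x₀}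
  condition : DeltaPrimeCondition (fun x => (F x : ℂ)) x₀ β

theorem IsSinglePointTestFunction.memLp_deriv (hF : IsSinglePointTestFunction Γ x₀ β F h) :
    MemLp (deriv h) 2 volume :=
  (contDiff_infty_iff_deriv.1 hF.contDiff).2.continuous.memLp_of_hasCompactSupport
    hF.hasCompactSupport_deriv.deriv

theorem IsSinglePointTestFunction.deriv_ofReal (hF : IsSinglePointTestFunction Γ x₀ β F h) {x : ℝ}
    (hx : x ≠ x₀) : deriv (fun x => (F x : ℂ)) x = h x :=
  (hF.hasDerivAt x hx).ofReal_comp.deriv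

theorem IsSinglePointTestFunction.integral_mul_smul_eq
    (hF : IsSinglePointTestFunction Γ x₀ β F h) {u v : L2R}
    (hweak : ∀ G : ℝ → ℝ, ContDiff ℝ ∞ G → HasCompactSupport G → tsupport (deriv G) ⊆ Γᶜ →
      ∫ x, G x • v x = -∫ x, deriv (deriv G) x • u x)
    {f : ℝ → ℂ} (hu : u =ᵐ[volume] f) {η : ℝ → ℝ} (hη : ContDiff ℝ ∞ η) (hη₀ : η =ᶠ[𝓝 x₀] 0)
    (hηΓ : tsupport (deriv η) ⊆ Γᶜ) :
    ∫ x, (η x * F x) • v x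
      = -((∫ x, (deriv (deriv η) x • (F x * f x)
            + 2 * deriv η x • (deriv (fun x => (F x : ℂ)) x * f x)))
          + ∫ x, (η x * deriv h x) • u x) := by
  have hηdiff : Differentiable ℝ η := hη.differentiable (by simp)
  have hG := contDiff_mul_of_eventuallyEq_zero hF.hasDerivAt hF.contDiff hη hη₀
  have hGs : HasCompactSupport fun x => η x * F x := hF.hasCompactSupport.mul_left
  have hint : Integrable fun x => deriv (deriv fun x => η x * F x) x • u x :=
    integrable_smul_coeFn ((contDiff_infty_iff_deriv.1
      (contDiff_infty_iff_deriv.1 hG).2).2.continuous.memLp_of_hasCompactSupport hGs.deriv.deriv) u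
  have hh' : Continuous (deriv h) := (contDiff_infty_iff_deriv.1 hF.contDiff).2.continuous
  have hint' : Integrable fun x => (η x * deriv h x) • u x :=
    integrable_smul_coeFn ((hη.continuous.mul hh').memLp_of_hasCompactSupport
      hF.hasCompactSupport_deriv.deriv.mul_left) u
  rw [hweak _ hG hGs (tsupport_deriv_mul_subset hF.hasDerivAt hηdiff hη₀ hF.inter_tsupport_subset
    hηΓ), neg_inj, ← sub_eq_iff_eq_add, ← integral_sub hint hint',
    deriv_deriv_mul_of_eventuallyEq_zero hF.hasDerivAt (hF.contDiff.differentiable (by simp))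
      (contDiff_infty.1 hη 2) hη₀]
  refine integral_congr_ae ?_
  filter_upwards [hu, Measure.ae_ne volume x₀] with x hx hx₀
  rw [hF.deriv_ofReal hx₀, ← sub_smul, add_sub_cancel_right, hx]
  simp only [Complex.real_smul]
  push_cast
  ring

theorem IsSinglePointTestFunction.eventually_integral_excision_smul
    (hF : IsSinglePointTestFunction Γ x₀ β F h) (hiso : Γᶜ ∈ 𝓝[≠] x₀) {u v : L2R}
    (hweak : ∀ G : ℝ → ℝ, ContDiff ℝ ∞ G → HasCompactSupport G → tsupport (deriv G) ⊆ Γᶜ →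
      ∫ x, G x • v x = -∫ x, deriv (deriv G) x • u x)
    {f : ℝ → ℂ} (hu : u =ᵐ[volume] f) (hdiff : ∀ᶠ x in 𝓝[≠] x₀, DifferentiableAt ℝ f x)
    (hf : DeltaPrimeCondition f x₀ β) :
    ∀ᶠ δ in 𝓝[>] 0, ∫ x, excision x₀ δ x • (F x • v x)
      = -((∫ x, deriv (excision x₀ δ) x •
            (deriv (fun x => (F x : ℂ)) x * f x - F x * deriv f x))
          + ∫ x, excision x₀ δ x • (deriv h x • u x)) := by
  have hgm : AEStronglyMeasurable (fun x => (F x : ℂ)) volume :=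
    hF.memLp.ofReal.aestronglyMeasurable
  have hfm : AEStronglyMeasurable f volume := (Lp.aestronglyMeasurable u).congr hu
  filter_upwards [eventually_tsupport_deriv_excision_subset hiso,
    eventually_tsupport_deriv_excision_subset hdiff,
    eventually_integrable_deriv_excision_smul ((aestronglyMeasurable_deriv _ volume).mul hfm)
      (by simpa using hF.condition.isBigO_deriv_one.mul hf.isBigO_one),
    eventually_integrable_deriv_excision_smul (hgm.mul (aestronglyMeasurable_deriv f volume))
      (by simpa using hF.condition.isBigO_one.mul hf.isBigO_deriv_one),
    self_mem_nhdsWithin] with δ hδΓ hδf hint hint' hδ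
  have hdiff' (x) (hx : x ∈ tsupport (deriv (excision x₀ δ))) :
      DifferentiableAt ℝ (fun x => (F x : ℂ)) x :=
    (hF.hasDerivAt x (tsupport_deriv_excision_subset hδ hx).2).ofReal_comp.differentiableAt
  have hη' : ContDiff ℝ 1 (deriv (excision x₀ δ)) :=
    (contDiff_infty.1 (contDiff_excision x₀ δ) 2).deriv'
  rw [← integral_deriv_smul_mul_add hη' (hasCompactSupport_deriv_excision hδ) hdiff' hδf hint hint']
  simpa only [smul_smul] using hF.integral_mul_smul_eq hweak hu (contDiff_excision x₀ δ)
    (excision_eventuallyEq_zero x₀ δ) hδΓ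

theorem IsSinglePointTestFunction.integral_smul_eq
    (hF : IsSinglePointTestFunction Γ x₀ β F h) (hiso : Γᶜ ∈ 𝓝[≠] x₀) {u v : L2R}
    (hweak : ∀ G : ℝ → ℝ, ContDiff ℝ ∞ G → HasCompactSupport G → tsupport (deriv G) ⊆ Γᶜ →
      ∫ x, G x • v x = -∫ x, deriv (deriv G) x • u x)
    {f : ℝ → ℂ} (hu : u =ᵐ[volume] f) (hdiff : ∀ᶠ x in 𝓝[≠] x₀, DifferentiableAt ℝ f x)
    (hf : DeltaPrimeCondition f x₀ β) :
    ∫ x, F x • v x = -∫ x, deriv h x • u x := by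
  have hgm : AEStronglyMeasurable (fun x => (F x : ℂ)) volume :=
    hF.memLp.ofReal.aestronglyMeasurable
  have hfm : AEStronglyMeasurable f volume := (Lp.aestronglyMeasurable u).congr hu
  obtain ⟨l, hl⟩ := hF.condition.exists_tendsto_wronskian hf
  have hwronskian := tendsto_integral_deriv_excision_smul
    (((aestronglyMeasurable_deriv (fun x => (F x : ℂ)) volume).mul hfm).sub
      (hgm.mul (aestronglyMeasurable_deriv f volume))) hl
  have hlim := (hwronskian.add (tendsto_integral_excision_smul
    (integrable_smul_coeFn hF.memLp_deriv u) x₀)).neg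
  rw [zero_add] at hlim
  exact tendsto_nhds_unique (tendsto_integral_excision_smul (integrable_smul_coeFn hF.memLp v) x₀)
    (hlim.congr' ((hF.eventually_integral_excision_smul hiso hweak hu hdiff hf).mono
      fun _ h => h.symm))

end SinglePoint

section Membership

variable {Γ : Set ℝ} {A : L2R →ₗ.[ℂ] L2R}

theorem cutoff_mem_graph (hclosed : IsClosed Γ) (hnull : volume Γ = 0) (hA : IsSelfAdjoint A)
    (hmin : ExtendsMinimal Γ A)
    (hcut : ∀ χ : ℝ → ℂ, IsCutoff Γ χ → ∀ w : L2R, w =ᵐ[volume] χ → w ∈ A.domain)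
    {χ : ℝ → ℂ} (hχ : IsCutoff Γ χ) {w v : L2R} (hw : w =ᵐ[volume] χ)
    (hv : v =ᵐ[volume] fun x => -deriv (deriv χ) x) : (w, v) ∈ A.graph := by
  have hmem := hcut χ hχ w hw
  set y : L2R := A ⟨w, hmem⟩
  refine (LinearPMap.mem_graph_iff _).2 ⟨⟨w, hmem⟩, rfl, Lp.ext ?_⟩
  have hweak (φ : ℝ → ℝ) (hφ : ContDiff ℝ ∞ φ) (hφs : HasCompactSupport φ)
      (hφΓ : tsupport φ ⊆ Γᶜ) : ∫ x, φ x • (y x - v x) = 0 := by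
    have hφ' := (contDiff_infty_iff_deriv.1 hφ).2
    have hφ'' := (contDiff_infty_iff_deriv.1 hφ').2
    have hφL : MemLp φ 2 volume := hφ.continuous.memLp_of_hasCompactSupport hφs
    obtain ⟨p, hp⟩ := exists_ae_eq_ofReal hφL
    obtain ⟨q, hq⟩ := exists_ae_eq_ofReal (μ := volume)
      (hφ''.continuous.neg.memLp_of_hasCompactSupport hφs.deriv.deriv.neg)
    have hpq : (p, q) ∈ A.graph := by
      refine hmin _ (isTestFunction_ofReal hφ hφs hφΓ) p q hp ?_
      simpa [deriv_deriv_ofReal_comp (contDiff_infty.1 hφ 2)] using hq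
    obtain ⟨p, rfl, rfl⟩ := (LinearPMap.mem_graph_iff _).1 hpq
    have hinner : ∫ x, φ x • y x = ∫ x, φ x • v x :=
      calc ∫ x, φ x • y x = inner ℂ (A p) w := by
            rw [← inner_eq_integral_smul hp, inner_apply_eq_inner_apply hA p ⟨w, hmem⟩]
        _ = ∫ x, -(deriv (deriv φ) x • χ x) := by
            rw [inner_eq_integral_smul hq]
            exact integral_congr_ae (hw.mono fun x hx => by simp [hx])
        _ = ∫ x, -(φ x • deriv (deriv χ) x) := by
            rw [integral_neg, integral_neg, integral_deriv_deriv_smul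
              (contDiff_infty.1 hφ 2) hφs (contDiff_infty.1 hχ.1.1 2)]
        _ = ∫ x, φ x • v x := integral_congr_ae (hv.mono fun x hx => by simp [hx])
    simp only [smul_sub]
    rw [integral_sub (integrable_smul_coeFn hφL y) (integrable_smul_coeFn hφL v), hinner, sub_self]
  have hloc : LocallyIntegrableOn (fun x => y x - v x) Γᶜ volume :=
    (((Lp.memLp y).sub (Lp.memLp v)).locallyIntegrable one_le_two).locallyIntegrableOn _
  filter_upwards [hclosed.isOpen_compl.ae_eq_zero_of_integral_contDiff_smul_eq_zero hloc hweak,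
    measure_eq_zero_iff_ae_notMem.1 hnull] with x hx hxΓ
  exact sub_eq_zero.1 (hx hxΓ)

theorem integral_smul_apply_of_isCutoff (hclosed : IsClosed Γ) (hnull : volume Γ = 0)
    (hA : IsSelfAdjoint A) (hmin : ExtendsMinimal Γ A)
    (hcut : ∀ χ : ℝ → ℂ, IsCutoff Γ χ → ∀ w : L2R, w =ᵐ[volume] χ → w ∈ A.domain)
    {G : ℝ → ℝ} (hG : ContDiff ℝ ∞ G) (hs : HasCompactSupport G)
    (hGΓ : tsupport (deriv G) ⊆ Γᶜ) (u : A.domain) :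
    ∫ x, G x • A u x = -∫ x, deriv (deriv G) x • (u : L2R) x := by
  have hG' := (contDiff_infty_iff_deriv.1 hG).2
  have hG'' := (contDiff_infty_iff_deriv.1 hG').2
  obtain ⟨w, hw⟩ := exists_ae_eq_ofReal (μ := volume) (hG.continuous.memLp_of_hasCompactSupport hs)
  obtain ⟨v, hv⟩ := exists_ae_eq_ofReal (μ := volume)
    (hG''.continuous.neg.memLp_of_hasCompactSupport hs.deriv.deriv.neg)
  have hwv : (w, v) ∈ A.graph := by
    refine cutoff_mem_graph hclosed hnull hA hmin hcut (isCutoff_ofReal hG hs hGΓ) hw ?_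
    simpa [deriv_deriv_ofReal_comp (contDiff_infty.1 hG 2)] using hv
  obtain ⟨w, rfl, rfl⟩ := (LinearPMap.mem_graph_iff _).1 hwv
  rw [← inner_eq_integral_smul hw, ← inner_apply_eq_inner_apply hA, inner_eq_integral_smul hv,
    ← integral_neg]
  simp only [Pi.neg_apply, neg_smul]

theorem IsIsolatedPoint.compl_mem_nhdsNE {x₀ : ℝ} (hx₀ : IsIsolatedPoint Γ x₀) : Γᶜ ∈ 𝓝[≠] x₀ :=
  Filter.not_frequently.1 (accPt_iff_frequently_nhdsNE.not.1 hx₀.2)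

theorem IsSinglePointTestFunction.mem_graph (hclosed : IsClosed Γ) (hnull : volume Γ = 0)
    (hA : IsSelfAdjoint A) (hmin : ExtendsMinimal Γ A)
    (hcut : ∀ χ : ℝ → ℂ, IsCutoff Γ χ → ∀ w : L2R, w =ᵐ[volume] χ → w ∈ A.domain)
    {x₀ β : ℝ} (hx₀ : IsIsolatedPoint Γ x₀) (hβ : HasIntensity A x₀ β) {F h : ℝ → ℝ}
    (hF : IsSinglePointTestFunction Γ x₀ β F h) {w v : L2R}
    (hw : w =ᵐ[volume] fun x => (F x : ℂ)) (hv : v =ᵐ[volume] fun x => ((-deriv h x : ℝ) : ℂ)) :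
    (w, v) ∈ A.graph := by
  refine mem_graph_of_forall_inner_eq hA fun u => ?_
  obtain ⟨f, hu, hdiff, hf⟩ := hβ u u.2
  rw [inner_eq_integral_smul hv, inner_eq_integral_smul hw,
    hF.integral_smul_eq hx₀.compl_mem_nhdsNE
      (fun G hG hs hGΓ => integral_smul_apply_of_isCutoff hclosed hnull hA hmin hcut hG hs hGΓ u)
      hu hdiff hf, ← integral_neg]
  simp only [neg_smul]

end Membership

section CutPrimitive

variable {h : ℝ → ℝ} {x₀ : ℝ}

/-- The primitive of `h` off `x₀` that vanishes at `±∞`: it equals `∫_{-∞}^x h` on the left of `x₀`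
and `-∫_x^∞ h` on the right, so it jumps by `-∫ h` at `x₀`. -/
noncomputable def cutPrimitive (x₀ : ℝ) (h : ℝ → ℝ) (x : ℝ) : ℝ :=
  (∫ y in Iic x, h y) - (Ioi x₀).indicator (fun _ => ∫ y, h y) x

theorem hasDerivAt_integral_Iic (hh : Continuous h) (hint : Integrable h) (x : ℝ) :
    HasDerivAt (fun x => ∫ y in Iic x, h y) (h x) x := by
  have hsplit : (fun x => ∫ y in Iic x, h y) = fun x => (∫ y in Iic 0, h y) + ∫ y in 0..x, h y :=
    funext fun x => (eq_add_of_sub_eq' (intervalIntegral.integral_Iic_sub_Iic hint.integrableOn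
      hint.integrableOn))
  rw [hsplit]
  exact (intervalIntegral.integral_hasDerivAt_right (hh.intervalIntegrable _ _)
    hh.stronglyMeasurable.stronglyMeasurableAtFilter hh.continuousAt).const_add _

theorem cutPrimitive_of_le {x : ℝ} (hx : x ≤ x₀) : cutPrimitive x₀ h x = ∫ y in Iic x, h y := by
  rw [cutPrimitive, indicator_of_notMem (notMem_Ioi.2 hx), sub_zero]

theorem cutPrimitive_of_lt {x : ℝ} (hx : x₀ < x) :
    cutPrimitive x₀ h x = (∫ y in Iic x, h y) - ∫ y, h y := by
  rw [cutPrimitive, indicator_of_mem (mem_Ioi.2 hx)]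

theorem hasDerivAt_cutPrimitive (hh : Continuous h) (hint : Integrable h) {x : ℝ} (hx : x ≠ x₀) :
    HasDerivAt (cutPrimitive x₀ h) (h x) x := by
  obtain hx | hx := hx.lt_or_gt
  · exact (hasDerivAt_integral_Iic hh hint x).congr_of_eventuallyEq
      ((eventually_lt_nhds hx).mono fun y hy => cutPrimitive_of_le hy.le)
  · exact ((hasDerivAt_integral_Iic hh hint x).sub_const _).congr_of_eventuallyEq
      ((eventually_gt_nhds hx).mono fun y hy => cutPrimitive_of_lt hy)

theorem hasCompactSupport_cutPrimitive (hint : Integrable h) (hs : HasCompactSupport h) (x₀ : ℝ) :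
    HasCompactSupport (cutPrimitive x₀ h) := by
  obtain ⟨R, hR⟩ := (hs.isCompact.insert x₀).isBounded.subset_closedBall 0
  have hout (y : ℝ) (hy : R < |y|) : y ∉ insert x₀ (tsupport h) := fun hmem =>
    hy.not_ge (by simpa using hR hmem)
  have hx₀ : |x₀| ≤ R := by simpa using hR (mem_insert x₀ _)
  refine HasCompactSupport.intro (isCompact_Icc (a := -R) (b := R)) fun x hx => ?_
  obtain hx | hx : x < -R ∨ R < x := by simpa [or_iff_not_imp_left] using hx
  · rw [cutPrimitive_of_le (by linarith [neg_le_of_abs_le hx₀])]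
    refine setIntegral_eq_zero_of_forall_eq_zero fun y hy => image_eq_zero_of_notMem_tsupport
      fun hmem => hout y (lt_abs.2 (.inr ?_)) (mem_insert_of_mem _ hmem)
    linarith [mem_Iic.1 hy]
  · rw [cutPrimitive_of_lt (by linarith [le_of_abs_le hx₀]), ← intervalIntegral.integral_Iic_add_Ioi
      hint.integrableOn hint.integrableOn, sub_add_cancel_left, neg_eq_zero]
    refine setIntegral_eq_zero_of_forall_eq_zero fun y hy => image_eq_zero_of_notMem_tsupport
      fun hmem => hout y (lt_abs.2 (.inl ?_)) (mem_insert_of_mem _ hmem)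
    exact hx.trans hy

theorem memLp_cutPrimitive (hh : Continuous h) (hint : Integrable h) (hs : HasCompactSupport h)
    (x₀ : ℝ) (p : ENNReal) : MemLp (cutPrimitive x₀ h) p volume := by
  have hcont : Continuous fun x => ∫ y in Iic x, h y :=
    continuous_iff_continuousAt.2 fun x => (hasDerivAt_integral_Iic hh hint x).continuousAt
  refine (hasCompactSupport_cutPrimitive hint hs x₀).memLp_of_bound
    (hcont.aestronglyMeasurable.sub
      (aestronglyMeasurable_const.indicator measurableSet_Ioi)) (2 * ∫ y, ‖h y‖)
    (ae_of_all _ fun x => ?_)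
  have hleft : ‖∫ y in Iic x, h y‖ ≤ ∫ y, ‖h y‖ := (norm_integral_le_integral_norm _).trans
    (setIntegral_le_integral hint.norm (ae_of_all _ fun _ => norm_nonneg _))
  have hright : ‖(Ioi x₀).indicator (fun _ => ∫ y, h y) x‖ ≤ ∫ y, ‖h y‖ :=
    (norm_indicator_le_norm_self _ _).trans (norm_integral_le_integral_norm _)
  rw [two_mul]
  exact (norm_sub_le _ _).trans (add_le_add hleft hright)

theorem deltaPrimeCondition_cutPrimitive (hh : Continuous h) (hint : Integrable h) {β : ℝ}
    (hβ : ∫ x, h x = -(β * h x₀)) :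
    DeltaPrimeCondition (fun x => (cutPrimitive x₀ h x : ℂ)) x₀ β := by
  have hlim : Tendsto (fun x => ∫ y in Iic x, h y) (𝓝 x₀) (𝓝 (∫ y in Iic x₀, h y)) :=
    (hasDerivAt_integral_Iic hh hint x₀).continuousAt
  have hderiv : Tendsto (deriv fun x => (cutPrimitive x₀ h x : ℂ)) (𝓝[≠] x₀) (𝓝 (h x₀)) :=
    (((Complex.continuous_ofReal.comp hh).tendsto x₀).mono_left nhdsWithin_le_nhds).congr'
      (eventually_mem_nhdsWithin.mono fun x hx =>
        (hasDerivAt_cutPrimitive hh hint hx).ofReal_comp.deriv.symm)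
  refine ⟨((∫ y in Iic x₀, h y) - ∫ y, h y : ℝ), (∫ y in Iic x₀, h y : ℝ), h x₀, h x₀,
    (Complex.continuous_ofReal.tendsto _).comp ?_, (Complex.continuous_ofReal.tendsto _).comp ?_,
    hderiv.mono_left (nhdsGT_le_nhdsNE x₀), hderiv.mono_left (nhdsLT_le_nhdsNE x₀), rfl, ?_⟩
  · exact ((hlim.sub_const _).mono_left nhdsWithin_le_nhds).congr'
      (eventually_mem_nhdsWithin.mono fun x hx => (cutPrimitive_of_lt hx).symm)
  · exact (hlim.mono_left nhdsWithin_le_nhds).congr'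
      (eventually_mem_nhdsWithin.mono fun x hx => (cutPrimitive_of_le (le_of_lt hx)).symm)
  · rw [hβ]
    push_cast
    ring

theorem integral_cutPrimitive_mul_deriv (hh : Continuous h) (hint : Integrable h) {g : ℝ → ℝ}
    (hg : ContDiff ℝ 1 g) (hs : HasCompactSupport g) :
    ∫ x, cutPrimitive x₀ h x * deriv g x = (∫ x, h x) * g x₀ - ∫ x, h x * g x := by
  have hg' : Continuous (deriv g) := hg.continuous_deriv le_rfl
  have hprim (x : ℝ) : HasDerivAt (fun x => ∫ y in Iic x, h y) (h x) x :=
    hasDerivAt_integral_Iic hh hint x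
  have hcont : Continuous fun x => ∫ y in Iic x, h y :=
    continuous_iff_continuousAt.2 fun x => (hprim x).continuousAt
  have hind (x : ℝ) : (Ioi x₀).indicator (fun x => (∫ y, h y) * deriv g x) x
      = (Ioi x₀).indicator (fun _ => ∫ y, h y) x * deriv g x := indicator_mul_left _ _ _
  have hint₁ : Integrable fun x => (∫ y in Iic x, h y) * deriv g x :=
    (hcont.mul hg').integrable_of_hasCompactSupport hs.deriv.mul_left
  have hint₂ : Integrable fun x => (Ioi x₀).indicator (fun _ => ∫ y, h y) x * deriv g x := by
    simp only [← hind]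
    exact ((hg'.integrable_of_hasCompactSupport hs.deriv).const_mul _).indicator measurableSet_Ioi
  have hparts : ∫ x, (∫ y in Iic x, h y) * deriv g x = -∫ x, h x * g x := by
    have hgh : Integrable fun x => g x * h x :=
      (hg.continuous.mul hh).integrable_of_hasCompactSupport hs.mul_right
    simpa only [smul_eq_mul, (hprim _).deriv, mul_comm] using integral_deriv_smul_eq_neg hg hs
      (fun x _ => (hprim x).differentiableAt) (by simpa only [smul_eq_mul, (hprim _).deriv])
  have hjump : ∫ x, (Ioi x₀).indicator (fun _ => ∫ y, h y) x * deriv g x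
      = -((∫ x, h x) * g x₀) := by
    simp only [← hind]
    rw [integral_indicator measurableSet_Ioi, integral_const_mul, hs.integral_Ioi_deriv_eq hg,
      mul_neg]
  simp only [cutPrimitive, sub_mul]
  rw [integral_sub hint₁ hint₂, hparts, hjump]
  ring

end CutPrimitive

section Profiles

theorem exists_contDiff_eq_one_tsupport_subset {E : Type*} [NormedAddCommGroup E] [NormedSpace ℝ E]
    [FiniteDimensional ℝ E] {K W : Set E} (hK : IsCompact K) (hW : IsOpen W) (hKW : K ⊆ W) :
    ∃ ψ : E → ℝ, ContDiff ℝ ∞ ψ ∧ HasCompactSupport ψ ∧ tsupport ψ ⊆ W ∧ (∀ x, ψ x ∈ Icc 0 1) ∧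
      ∀ x ∈ K, ψ x = 1 := by
  obtain ⟨V, hV, hKV, hVW, hVcompact⟩ := exists_open_between_and_isCompact_closure hK hW hKW
  obtain ⟨ψ, hψ, hrange, hsupp, hone⟩ :=
    exists_contMDiff_support_eq_eq_one_iff (n := ⊤) (modelWithCornersSelf ℝ E) hV hK.isClosed hKV
  have htsupp : tsupport ψ = closure V := congrArg closure hsupp
  exact ⟨ψ, hψ.contDiff, by rwa [HasCompactSupport, htsupp], htsupp.trans_subset hVW,
    fun x => hrange (mem_range_self x), fun x hx => (hone x).1 hx⟩

/-- A profile at `x₀` of mass `b`: a smooth, compactly supported `h : ℝ → [0, 1]` with `h x₀ = 1`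
and `∫ h = b`. These are the derivatives of the trial functions. -/
structure IsProfile (x₀ b : ℝ) (h : ℝ → ℝ) : Prop where
  contDiff : ContDiff ℝ ∞ h
  hasCompactSupport : HasCompactSupport h
  mem_Icc : ∀ x, h x ∈ Icc 0 1
  apply_center : h x₀ = 1
  integral_eq : ∫ x, h x = b

theorem IsProfile.integrable {x₀ b : ℝ} {h : ℝ → ℝ} (hh : IsProfile x₀ b h) : Integrable h :=
  hh.contDiff.continuous.integrable_of_hasCompactSupport hh.hasCompactSupport

theorem IsProfile.integral_mul_self_lt {x₀ b : ℝ} {h : ℝ → ℝ} (hh : IsProfile x₀ b h) :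
    ∫ x, h x * h x < b := by
  have hcont : Continuous h := hh.contDiff.continuous
  have hint : Integrable fun x => h x * h x :=
    (hcont.mul hcont).integrable_of_hasCompactSupport hh.hasCompactSupport.mul_left
  have hnonneg (x : ℝ) : 0 ≤ h x - h x * h x := by
    nlinarith [(hh.mem_Icc x).1, (hh.mem_Icc x).2]
  obtain ⟨y, hy⟩ : ∃ y, y ∉ tsupport h :=
    (ne_univ_iff_exists_notMem _).1 hh.hasCompactSupport.isCompact.ne_univ
  obtain ⟨z, hz⟩ : (1 / 2 : ℝ) ∈ range h := by
    refine mem_range_of_exists_le_of_exists_ge hcont ⟨y, ?_⟩ ⟨x₀, ?_⟩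
    · norm_num [image_eq_zero_of_notMem_tsupport hy]
    · norm_num [hh.apply_center]
  rw [← sub_pos, ← hh.integral_eq, ← integral_sub hh.integrable hint]
  exact (hcont.sub (hcont.mul hcont)).integral_pos_of_hasCompactSupport_nonneg_nonzero
    (hh.hasCompactSupport.sub hh.hasCompactSupport.mul_left) hnonneg (x := z)
    (by norm_num [hz])

theorem IsProfile.exists_of_mem_Icc {x₀ b s t : ℝ} {φ ψ : ℝ → ℝ} (hφ : IsProfile x₀ s φ)
    (hψ : IsProfile x₀ t ψ) (hb : b ∈ Icc s t) :
    ∃ h, IsProfile x₀ b h ∧ tsupport h ⊆ tsupport φ ∪ tsupport ψ := by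
  rw [← segment_eq_Icc (hb.1.trans hb.2)] at hb
  obtain ⟨p, q, hp, hq, hpq, rfl⟩ := hb
  refine ⟨fun x => p * φ x + q * ψ x, ⟨?_, ?_, fun x => ?_, ?_, ?_⟩, ?_⟩
  · exact (contDiff_const.mul hφ.contDiff).add (contDiff_const.mul hψ.contDiff)
  · exact hφ.hasCompactSupport.mul_left.add hψ.hasCompactSupport.mul_left
  · exact convex_Icc 0 1 (hφ.mem_Icc x) (hψ.mem_Icc x) hp hq hpq
  · rw [hφ.apply_center, hψ.apply_center, mul_one, mul_one, hpq]
  · rw [integral_add (hφ.integrable.const_mul p) (hψ.integrable.const_mul q), integral_const_mul,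
      integral_const_mul, hφ.integral_eq, hψ.integral_eq, smul_eq_mul, smul_eq_mul]
  · exact (tsupport_add _ _).trans
      (union_subset_union tsupport_mul_subset_right tsupport_mul_subset_right)

theorem exists_isProfile_tsupport_subset {W : Set ℝ} (hW : IsOpen W) {x₀ b : ℝ} (hx₀ : x₀ ∈ W)
    (hb : 0 < b) (hbW : ENNReal.ofReal b < volume W) :
    ∃ h, IsProfile x₀ b h ∧ tsupport h ⊆ W := by
  obtain ⟨K, hKW, hK, hbK⟩ := hW.exists_lt_isCompact hbW
  obtain ⟨ψ, hψ, hψs, hψW, hψI, hψK⟩ := exists_contDiff_eq_one_tsupport_subset (hK.insert x₀) hW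
    (insert_subset hx₀ hKW)
  obtain ⟨φ, hφ, hφs, hφW, hφI, hφ₀⟩ := exists_contDiff_eq_one_tsupport_subset
    (isCompact_singleton (x := x₀)) (hW.inter (Metric.isOpen_ball (x := x₀) (ε := b / 2)))
    (singleton_subset_iff.2 ⟨hx₀, Metric.mem_ball_self (half_pos hb)⟩)
  have hφb : ∫ x, φ x ≤ b := by
    refine (ENNReal.ofReal_le_ofReal_iff hb.le).1 ?_
    calc ENNReal.ofReal (∫ x, φ x) ≤ volume (Metric.ball x₀ (b / 2)) :=
          integral_le_measure (fun x _ => (hφI x).2) fun x hx =>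
            (image_eq_zero_of_notMem_tsupport fun hmem => hx (hφW hmem).2).le
      _ = ENNReal.ofReal b := by rw [Real.volume_ball, mul_div_cancel₀ b two_ne_zero]
  have hψb : b ≤ ∫ x, ψ x := by
    have hKfin : volume K ≠ ⊤ := hK.measure_ne_top
    calc b ≤ volume.real K := (ENNReal.ofReal_lt_iff_lt_toReal hb.le hKfin).1 hbK |>.le
      _ = ∫ x, K.indicator 1 x := (integral_indicator_one hK.measurableSet).symm
      _ ≤ ∫ x, ψ x := integral_mono
          ((integrable_indicator_iff hK.measurableSet).2 (integrableOn_const hKfin))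
          (hψ.continuous.integrable_of_hasCompactSupport hψs)
          (indicator_le' (fun x hx => (hψK x (mem_insert_of_mem _ hx)).ge) fun x _ => (hψI x).1)
  obtain ⟨h, hh, hsupp⟩ := IsProfile.exists_of_mem_Icc
    (⟨hφ, hφs, hφI, hφ₀ x₀ rfl, rfl⟩ : IsProfile x₀ _ φ)
    (⟨hψ, hψs, hψI, hψK x₀ (mem_insert _ _), rfl⟩ : IsProfile x₀ _ ψ) ⟨hφb, hψb⟩
  exact ⟨h, hh, hsupp.trans (union_subset (hφW.trans inter_subset_left) hψW)⟩

end Profiles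

section TrialFunctions

variable {Γ : Set ℝ} {A : L2R →ₗ.[ℂ] L2R}

theorem exists_pairwise_disjoint_isOpen {ι : Type*} [Finite ι] (hclosed : IsClosed Γ)
    (hnull : volume Γ = 0) {x : ι → ℝ} (hx : Function.Injective x)
    (hiso : ∀ k, IsIsolatedPoint Γ (x k)) {L : ℝ} (hL : 0 ≤ L) :
    ∃ W : ι → Set ℝ, Pairwise (Function.onFun Disjoint W) ∧ ∀ k, IsOpen (W k) ∧ x k ∈ W k ∧
      Γ ∩ W k ⊆ {x k} ∧ ENNReal.ofReal L ≤ volume (W k) := by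
  obtain ⟨U, hU, hUdisj⟩ := (finite_range x).t2_separation
  obtain ⟨M, hM⟩ := (finite_range x).bddAbove
  choose O hO hxO hOΓ using fun k => mem_nhdsWithin.1 (hiso k).compl_mem_nhdsNE
  obtain ⟨e, he⟩ := exists_injective_nat ι
  let V (k : ι) : Set ℝ := U (x k) ∩ O k ∩ Iio (M + 1)
  let I (k : ι) : Set ℝ := Ioo (M + 1 + (e k : ℤ) • L) (M + 1 + ((e k : ℤ) + 1) • L)
  have hVdisj {j k : ι} (hjk : j ≠ k) : Disjoint (V j) (V k) :=
    (hUdisj (mem_range_self j) (mem_range_self k) (hx.ne hjk)).mono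
      (inter_subset_left.trans inter_subset_left) (inter_subset_left.trans inter_subset_left)
  have hIdisj {j k : ι} (hjk : j ≠ k) : Disjoint (I j) (I k) :=
    pairwise_disjoint_Ioo_add_zsmul (M + 1) L (Nat.cast_injective.ne (he.ne hjk))
  have hVI (j k : ι) : Disjoint (V j) (I k) :=
    disjoint_left.2 fun y hyV hyI => by
      have : (0 : ℝ) ≤ (e k : ℤ) • L := by positivity
      linarith [hyV.2.out, hyI.1]
  refine ⟨fun k => V k ∪ I k \ Γ, fun j k hjk => ?_, fun k => ⟨?_, .inl ⟨⟨(hU _).1, hxO k⟩, ?_⟩,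
    ?_, ?_⟩⟩
  · exact disjoint_union_left.2
      ⟨disjoint_union_right.2 ⟨hVdisj hjk, (hVI j k).mono_right sdiff_subset⟩,
        disjoint_union_right.2 ⟨((hVI k j).mono_right sdiff_subset).symm,
          (hIdisj hjk).mono sdiff_subset sdiff_subset⟩⟩
  · exact (((hU _).2.inter (hO k)).inter isOpen_Iio).union (isOpen_Ioo.sdiff hclosed)
  · exact (hM (mem_range_self k)).trans_lt (lt_add_one M)
  · rintro y ⟨hyΓ, hyV | hyI⟩
    · exact by_contra fun hne => hOΓ k ⟨hyV.1.2, hne⟩ hyΓ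
    · exact (hyI.2 hyΓ).elim
  · calc ENNReal.ofReal L = volume (I k) := by
          rw [Real.volume_Ioo, add_sub_add_left_eq_sub, add_one_zsmul, add_sub_cancel_left]
      _ = volume (I k \ Γ) := (measure_sdiff_null hnull).symm
      _ ≤ volume (V k ∪ I k \ Γ) := measure_mono subset_union_right

theorem IsProfile.isSinglePointTestFunction_cutPrimitive {x₀ β : ℝ} {h : ℝ → ℝ}
    (hh : IsProfile x₀ (-β) h) (hΓ : Γ ∩ tsupport h ⊆ {x₀}) :
    IsSinglePointTestFunction Γ x₀ β (cutPrimitive x₀ h) h where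
  contDiff := hh.contDiff
  hasCompactSupport_deriv := hh.hasCompactSupport
  hasCompactSupport := hasCompactSupport_cutPrimitive hh.integrable hh.hasCompactSupport x₀
  memLp := memLp_cutPrimitive hh.contDiff.continuous hh.integrable hh.hasCompactSupport x₀ 2
  hasDerivAt _ hx := hasDerivAt_cutPrimitive hh.contDiff.continuous hh.integrable hx
  inter_tsupport_subset := hΓ
  condition := deltaPrimeCondition_cutPrimitive hh.contDiff.continuous hh.integrable
    (by rw [hh.integral_eq, hh.apply_center, mul_one])

theorem inner_cutPrimitive_neg_deriv {x₀ : ℝ} {h g : ℝ → ℝ} (hh : Continuous h)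
    (hint : Integrable h) (hg : ContDiff ℝ 1 g) (hs : HasCompactSupport g) {w v : L2R}
    (hw : w =ᵐ[volume] fun x => (cutPrimitive x₀ h x : ℂ))
    (hv : v =ᵐ[volume] fun x => ((-deriv g x : ℝ) : ℂ)) :
    inner ℂ w v = ((∫ x, h x * g x) - (∫ x, h x) * g x₀ : ℝ) := by
  calc inner ℂ w v = ∫ x, cutPrimitive x₀ h x • v x := inner_eq_integral_smul hw v
    _ = ∫ x, ((-(cutPrimitive x₀ h x * deriv g x) : ℝ) : ℂ) := by
        refine integral_congr_ae (hv.mono fun x hx => ?_)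
        simp only [hx, Complex.real_smul, ← Complex.ofReal_mul, mul_neg]
    _ = _ := by
        rw [integral_complex_ofReal, integral_neg, integral_cutPrimitive_mul_deriv hh hint hg hs,
          neg_sub]

theorem IsSinglePointTestFunction.exists_mem_domain {x₀ β : ℝ} {F h : ℝ → ℝ}
    (hF : IsSinglePointTestFunction Γ x₀ β F h) (hclosed : IsClosed Γ) (hnull : volume Γ = 0)
    (hA : IsSelfAdjoint A) (hmin : ExtendsMinimal Γ A)
    (hcut : ∀ χ : ℝ → ℂ, IsCutoff Γ χ → ∀ w : L2R, w =ᵐ[volume] χ → w ∈ A.domain)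
    (hx₀ : IsIsolatedPoint Γ x₀) (hβ : HasIntensity A x₀ β) :
    ∃ f : A.domain, (f : L2R) =ᵐ[volume] (fun x => (F x : ℂ)) ∧
      A f =ᵐ[volume] fun x => ((-deriv h x : ℝ) : ℂ) := by
  obtain ⟨w, hw⟩ := exists_ae_eq_ofReal hF.memLp
  obtain ⟨v, hv⟩ := exists_ae_eq_ofReal hF.memLp_deriv.neg
  obtain ⟨f, rfl, rfl⟩ := (LinearPMap.mem_graph_iff A).1
    (hF.mem_graph hclosed hnull hA hmin hcut hx₀ hβ hw hv)
  exact ⟨f, hw, hv⟩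

theorem exists_isProfile_family {ι : Type*} [Finite ι] (hclosed : IsClosed Γ)
    (hnull : volume Γ = 0) {x b : ι → ℝ} (hx : Function.Injective x)
    (hiso : ∀ k, IsIsolatedPoint Γ (x k)) (hb : ∀ k, 0 < b k) :
    ∃ h : ι → ℝ → ℝ, (∀ k, IsProfile (x k) (b k) (h k)) ∧ (∀ k, Γ ∩ tsupport (h k) ⊆ {x k}) ∧
      ∀ j k, j ≠ k → ∀ y, h j y = 0 ∨ h k y = 0 := by
  obtain ⟨M, hM⟩ := (finite_range b).bddAbove
  obtain ⟨W, hWdisj, hW⟩ := exists_pairwise_disjoint_isOpen hclosed hnull hx hiso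
    (L := max 0 (M + 1)) (le_max_left _ _)
  have hprofile (k : ι) : ∃ h, IsProfile (x k) (b k) h ∧ tsupport h ⊆ W k := by
    obtain ⟨hWopen, hxW, -, hWvol⟩ := hW k
    refine exists_isProfile_tsupport_subset hWopen hxW (hb k) (hWvol.trans_lt' ?_)
    have hbM : b k < max 0 (M + 1) :=
      lt_max_of_lt_right ((hM (mem_range_self k)).trans_lt (lt_add_one M))
    exact (ENNReal.ofReal_lt_ofReal_iff ((hb k).trans hbM)).2 hbM
  choose h hh hhW using hprofile
  refine ⟨h, hh, fun k => (inter_subset_inter_right _ (hhW k)).trans (hW k).2.2.1,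
    fun j k hjk y => ?_⟩
  by_contra! hne
  exact disjoint_left.1 (hWdisj hjk) (hhW j (subset_tsupport _ hne.1))
    (hhW k (subset_tsupport _ hne.2))

theorem card_le_numNegativeEigenvalues_of_hasIntensity {ι : Type*} [Fintype ι]
    (hclosed : IsClosed Γ) (hnull : volume Γ = 0) (hA : IsSelfAdjoint A)
    (hmin : ExtendsMinimal Γ A)
    (hcut : ∀ χ : ℝ → ℂ, IsCutoff Γ χ → ∀ w : L2R, w =ᵐ[volume] χ → w ∈ A.domain)
    (hσ : ∀ t : ℝ, t < 0 → (t : ℂ) ∈ spectrumSet A → eigenspace A t ≠ ⊥)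
    {x β : ι → ℝ} (hx : Function.Injective x) (hiso : ∀ k, IsIsolatedPoint Γ (x k))
    (hβ : ∀ k, β k < 0) (hintensity : ∀ k, HasIntensity A (x k) (β k)) :
    (Fintype.card ι : ℕ∞) ≤ numNegativeEigenvalues A := by
  obtain ⟨h, hh, hhΓ, hdisj⟩ := exists_isProfile_family hclosed hnull hx hiso
    (b := fun k => -β k) fun k => neg_pos.2 (hβ k)
  choose f hf hAf using fun k =>
    ((hh k).isSinglePointTestFunction_cutPrimitive (hhΓ k)).exists_mem_domain hclosed hnull hA hmin
      hcut (hiso k) (hintensity k)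
  have hform (j k : ι) : inner ℂ (f j : L2R) (A (f k))
      = ((∫ y, h j y * h k y) - -β j * h k (x j) : ℝ) := by
    rw [inner_cutPrimitive_neg_deriv (hh j).contDiff.continuous (hh j).integrable
      (contDiff_infty.1 (hh k).contDiff 1) (hh k).hasCompactSupport (hf j) (hAf k),
      (hh j).integral_eq]
  refine card_le_numNegativeEigenvalues hA hσ f (fun j k hjk => ?_) fun k => ?_
  · have hmul (y : ℝ) : h j y * h k y = 0 := mul_eq_zero.2 (hdisj j k hjk y)
    have hzero : h k (x j) = 0 := (hdisj j k hjk (x j)).resolve_left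
      ((hh j).apply_center.trans_ne one_ne_zero)
    simp [hform, hmul, hzero]
  · rw [hform, Complex.ofReal_re, (hh k).apply_center, mul_one, sub_neg]
    exact (hh k).integral_mul_self_lt

end TrialFunctions

end DeltaPrime

theorem theorem1_general (Γ : Set ℝ) (hclosed : IsClosed Γ) (hnull : volume Γ = 0)
    (A : DeltaPrime.L2R →ₗ.[ℂ] DeltaPrime.L2R) (hA : IsSelfAdjoint A)
    (hmin : DeltaPrime.ExtendsMinimal Γ A)
    (hcut : ∀ χ : ℝ → ℂ, DeltaPrime.IsCutoff Γ χ → ∀ w : DeltaPrime.L2R,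
      w =ᵐ[volume] χ → w ∈ A.domain)
    (hσ : ∀ t : ℝ, t < 0 → (t : ℂ) ∈ DeltaPrime.spectrumSet A → DeltaPrime.eigenspace A t ≠ ⊥) :
    (DeltaPrime.negativeIntensityPoints Γ A).encard ≤ DeltaPrime.numNegativeEigenvalues A := by
  refine ENat.forall_natCast_le_iff_le.1 fun N hN => ?_
  obtain ⟨S, hS, hcard⟩ := exists_subset_encard_eq hN
  have := (finite_of_encard_eq_coe hcard).fintype
  choose hiso β hβ hintensity using fun k : S => hS k.2
  rw [← hcard, ← coe_fintypeCard]
  exact DeltaPrime.card_le_numNegativeEigenvalues_of_hasIntensity hclosed hnull hA hmin hcut hσ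
    Subtype.val_injective hiso hβ hintensity

theorem theorem1 (Γ : Set ℝ) (hclosed : IsClosed Γ) (hbounded : Bornology.IsBounded Γ)
    (hnull : MeasureTheory.volume Γ = 0)
    (A : DeltaPrime.L2R →ₗ.[ℂ] DeltaPrime.L2R)
    (hA : DeltaPrime.IsDeltaPrimeInteraction Γ A)
    (hdiscrete : DeltaPrime.NegativeSpectrumDiscrete A) :
    (DeltaPrime.negativeIntensityPoints Γ A).encard ≤ DeltaPrime.numNegativeEigenvalues A :=
  theorem1_general Γ hclosed hnull A hA.selfAdjoint hA.extendsMinimal hA.cutoff_mem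
    fun t ht htσ => (hdiscrete t ht htσ).2.1
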